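/- Let $q$ be a prime power, let $\overline{F}_q$ be an algebraic closure of the field $F_q$ of $q$ elements, let $n\geq 1$, and let $G$ be one of the groups $GL_n(q)$, $SL_{n+1}(q)$, $Sp_{2n}(q)$, $SO_{2n+1}(q)$ ($q$ odd), $SO^+_{2n}(q)$ ($q$ odd), $Spin^+_{2n}(q)$ ($q$ even). Let $\mathbf{G}$ be the corresponding algebraic group over $\overline{F}_q$ and $F$ the corresponding (split) Frobenius map, so that $G=\mathbf{G}^F$. Let $\mathbf{T}$ be the diagonal maximal torus of $\mathbf{G}$ (for the spin group: the preimage of the diagonal torus of the group of the split form $\sum_i x_iy_i$), let $W=N_{\mathbf{G}}(\mathbf{T})/\mathbf{T}$ be the Weyl group, acting on the weights of $\mathbf{T}$, that is, on its characters $\mathbf{T}\to\overline{F}_q^{\times}$ (written additively), and let $\varepsilon_1,\ldots,\varepsilon_n$ be the standard weights: the first $n$ diagonal entries for $GL_n$ and $SL_{n+1}$, and, in the other cases, the eigenvalues on the first halves $e_1,\ldots,e_n$ of the $n$ standard hyperbolic pairs $(e_j,f_j)$ of the natural module. For $1\leq i\leq n$ put $\omega_i=\varepsilon_1+\cdots+\varepsilon_i$,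 $W_i=\{g\in W: g(\omega_i)=\omega_i\}$ and $\mu=(q-1)\omega_i$. Let $w\in W$ and let $x\in\mathbf{G}$ be such that $x^{-1}F(x)\in N_{\mathbf{G}}(\mathbf{T})$ represents $w$; then $T_w=(x\mathbf{T}x^{-1})^F$ is a maximal torus of $G$ corresponding to $w$ (and every maximal torus of $G$ corresponding to $w$ is of this form). Weights of $\mathbf{T}$ are viewed as characters of $x\mathbf{T}x^{-1}$ by means of conjugation by $x$. Then the number of distinct weights $g(\mu)$ $(g\in W)$ that are trivial on $T_w$ equals $1_{W_i}^W(w)$, the value at $w$ of the character of $W$ induced from the trivial character of $W_i$. This is also equal to the number of distinct weights $g(\omega_i)$ $(g\in W)$ such that $g(\omega_i)(T_w)\subseteq F_q$. -/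

import Mathlib

open scoped Matrix

universe u v

noncomputable section

/-! ### Reductive groups with a Frobenius map, Weyl groups, maximal tori and weights

The constructions common to all families are carried out for a group `G` of points (a subgroup of
an ambient group) with a Frobenius map, a reference torus and coordinate weights on this torus.
The classical groups are then built explicitly. -/

/-- A group of points over `K` inside an ambient group, with an endomorphism `frob` of the ambient
group, a reference torus, and `n` distinguished characters of the torus. -/
structure GroupWithTorus (K : Type v) [Field K] (n : ℕ) where
  /-- the ambient group -/
  Amb : Type v
  /-- its group structure -/
  [group : Group Amb]
  /-- the algebraic group (its group of points over `K`) -/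
  G : Subgroup Amb
  /-- the Frobenius map -/
  frob : Amb →* Amb
  /-- the reference torus -/
  torus : Subgroup Amb
  torus_le : torus ≤ G
  /-- the weights `ε₁, …, εₙ` of the reference torus -/
  ε : Fin n → (torus →* Kˣ)

namespace GroupWithTorus

variable {K : Type v} [Field K] {n : ℕ} (D : GroupWithTorus K n)

instance : Group D.Amb := D.group

/-- The normalizer of the reference torus in `G`. -/
def normalizer : Subgroup D.Amb := D.G ⊓ Subgroup.normalizer (D.torus : Set D.Amb)

/-- The reference torus as a subgroup of its normalizer. -/
def torusInNormalizer : Subgroup D.normalizer := D.torus.subgroupOf D.normalizer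

instance : D.torusInNormalizer.Normal := by
  constructor
  intro t ht m
  have hm := (Subgroup.mem_inf.1 m.2).2
  rw [torusInNormalizer, Subgroup.mem_subgroupOf] at ht ⊢
  exact (Subgroup.mem_normalizer_iff.1 hm _).1 ht

/-- The Weyl group `W = N_G(T)/T` of the reference torus. -/
def Weyl : Type v := D.normalizer ⧸ D.torusInNormalizer

instance : Group D.Weyl := inferInstanceAs (Group (D.normalizer ⧸ D.torusInNormalizer))

/-- The class in the Weyl group of an element of the normalizer. -/
def toWeyl : D.normalizer →* D.Weyl := QuotientGroup.mk' D.torusInNormalizer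

/-- For `m ∈ N_G(T)`, the homomorphism `t ↦ m⁻¹ t m` of the reference torus. -/
def conjTorus (m : D.normalizer) : D.torus →* D.torus where
  toFun t := ⟨(m : D.Amb)⁻¹ * t * m, by
    have hm := (Subgroup.mem_inf.1 m.2).2
    exact (Subgroup.mem_normalizer_iff''.1 hm _).1 t.2⟩
  map_one' := by ext; simp
  map_mul' s t := by ext; simp [mul_assoc]

/-- The action of `N_G(T)` on the characters of `T`: `(m • χ)(t) = χ(m⁻¹ t m)`. -/
def normalizerAct : D.normalizer →* Equiv.Perm (D.torus →* Kˣ) where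
  toFun m :=
    { toFun := fun χ => χ.comp (D.conjTorus m)
      invFun := fun χ => χ.comp (D.conjTorus m⁻¹)
      left_inv := fun χ => by ext t; simp [conjTorus, mul_assoc]
      right_inv := fun χ => by ext t; simp [conjTorus, mul_assoc] }
  map_one' := by ext χ t; simp [conjTorus]
  map_mul' a b := by ext χ t; simp [conjTorus, mul_assoc]

/-- The action of the Weyl group on the characters of `T`. -/
def weylAct : D.Weyl →* Equiv.Perm (D.torus →* Kˣ) :=
  QuotientGroup.lift D.torusInNormalizer D.normalizerAct (by
    intro m hm
    have hm' : (m : D.Amb) ∈ D.torus := hm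
    ext χ t
    have h : D.conjTorus m t = ⟨m, hm'⟩⁻¹ * t * ⟨m, hm'⟩ := by
      ext; simp [conjTorus]
    simp [normalizerAct, h, mul_comm])

instance : MulAction D.Weyl (D.torus →* Kˣ) where
  smul w χ := D.weylAct w χ
  one_smul χ := by
    change D.weylAct 1 χ = χ
    rw [map_one]; rfl
  mul_smul a b χ := by
    change D.weylAct (a * b) χ = D.weylAct a (D.weylAct b χ)
    rw [map_mul]; rfl

theorem toWeyl_smul_apply (m : D.normalizer) (χ : D.torus →* Kˣ) (t : D.torus) :
    (D.toWeyl m • χ) t = χ (D.conjTorus m t) := rfl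

/-- The weight `ωᵢ = ε₁ + ⋯ + εᵢ`. Characters are written multiplicatively, so that the weight
`k ωᵢ` is `D.ω i ^ k`. -/
def ω (i : ℕ) : D.torus →* Kˣ := ∏ j : Fin n with j.val < i, D.ε j

/-- `Wᵢ`, the stabilizer of `ωᵢ` in the Weyl group. -/
def weylStabilizer (i : ℕ) : Subgroup D.Weyl := MulAction.stabilizer D.Weyl (D.ω i)

/-- The finite group of Frobenius-fixed points of `G`. -/
def finiteGroup : Subgroup D.Amb := D.G ⊓ D.frob.eqLocus (MonoidHom.id D.Amb)

/-- The maximal torus `x T x⁻¹` obtained from the reference torus `T`. -/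
def conjugateTorus (x : D.Amb) : Subgroup D.Amb := D.torus.map (MulAut.conj x).toMonoidHom

/-- `x ∈ G` twists the reference torus by `w ∈ W`: `x⁻¹ F(x)` lies in `N_G(T)` and represents `w`.
The tori `x T x⁻¹` of this kind are the `F`-stable maximal tori of `G` corresponding to `w`. -/
def Twists (x : D.Amb) (w : D.Weyl) : Prop :=
  x ∈ D.G ∧ ∃ m : D.normalizer, (m : D.Amb) = x⁻¹ * D.frob x ∧ D.toWeyl m = w

/-- The finite maximal torus `(x T x⁻¹)^F`. -/
def finiteTorus (x : D.Amb) : Subgroup D.Amb := D.conjugateTorus x ⊓ D.finiteGroup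

theorem conj_mem {x t : D.Amb} (ht : t ∈ D.conjugateTorus x) : x⁻¹ * t * x ∈ D.torus := by
  obtain ⟨s, hs, rfl⟩ := ht
  simpa [mul_assoc] using hs

/-- A character of the reference torus `T`, transported to a character of `x T x⁻¹`. -/
def transport (x : D.Amb) (χ : D.torus →* Kˣ) : D.conjugateTorus x →* Kˣ :=
  χ.comp
    { toFun := fun t => ⟨x⁻¹ * t * x, D.conj_mem t.2⟩
      map_one' := by ext; simp
      map_mul' := fun s t => by ext; simp [mul_assoc] }

/-- The set of the distinct weights `g(χ)`, `g ∈ W`, viewed as characters of `x T x⁻¹`. -/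
def weightOrbit (x : D.Amb) (χ : D.torus →* Kˣ) : Set (D.conjugateTorus x →* Kˣ) :=
  {ν | ∃ g : D.Weyl, ν = D.transport x (g • χ)}

end GroupWithTorus

/-- The class function on a finite group `B` induced by a class function `χ` of a subgroup `A`:
`χ^B(b) = |A|⁻¹ ∑_{g ∈ B} χ°(g⁻¹ b g)`, where `χ°` is `χ` extended by zero outside `A`. -/
def inducedCharacter {B : Type*} [Group B] (A : Subgroup B) (χ : A → ℂ) (b : B) : ℂ :=
  open Classical in
  (Nat.card A : ℂ)⁻¹ * ∑ᶠ g : B, if h : g⁻¹ * b * g ∈ A then χ ⟨_, h⟩ else 0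

/-! ### Matrix groups -/

section MatrixGroups

variable {K : Type v} [Field K] {ι : Type} [Fintype ι] [DecidableEq ι]

/-- The invertible diagonal matrices. -/
def diagonalSubgroup (ι : Type) [Fintype ι] [DecidableEq ι] (K : Type v) [Field K] :
    Subgroup (GL ι K) :=
  (Units.map (Matrix.diagonalRingHom ι K : (ι → K) →* Matrix ι ι K)).range

theorem mem_diagonalSubgroup {g : GL ι K} (hg : g ∈ diagonalSubgroup ι K) :
    ∃ d : ι → K, (g : Matrix ι ι K) = Matrix.diagonal d := by
  obtain ⟨u, rfl⟩ := hg
  exact ⟨u, rfl⟩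

/-- The character of the diagonal matrices that takes the entry at position `(j, j)`. -/
def diagonalEntry (j : ι) : diagonalSubgroup ι K →* Kˣ :=
  MonoidHom.toHomUnits
    { toFun := fun t => ((t : GL ι K) : Matrix ι ι K) j j
      map_one' := by simp
      map_mul' := fun s t => by
        obtain ⟨a, ha⟩ := mem_diagonalSubgroup s.2
        obtain ⟨b, hb⟩ := mem_diagonalSubgroup t.2
        simp [ha, hb] }

/-- A matrix group with the entrywise Frobenius map `φ`, with the torus of its diagonal matrices,
and with the weights given by the diagonal entries at the positions `c 1, …, c n`. -/
def matrixGroupWithTorus {n : ℕ} (φ : K →+* K) (G : Subgroup (GL ι K)) (c : Fin n → ι) :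
    GroupWithTorus K n where
  Amb := GL ι K
  G := G
  frob := Matrix.GeneralLinearGroup.map φ
  torus := G ⊓ diagonalSubgroup ι K
  torus_le := inf_le_left
  ε j := (diagonalEntry (c j)).comp (Subgroup.inclusion inf_le_right)

/-- The special linear group, inside the general linear group. -/
def specialLinear (ι : Type) [Fintype ι] [DecidableEq ι] (K : Type v) [Field K] :
    Subgroup (GL ι K) := (Matrix.GeneralLinearGroup.det : GL ι K →* Kˣ).ker

/-- The matrices `g` with `gᵀ J g = J`, the isometry group of the form with Gram matrix `J`. -/
def isometryGroup (J : Matrix ι ι K) : Subgroup (GL ι K) where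
  carrier := {g | (g : Matrix ι ι K)ᵀ * J * (g : Matrix ι ι K) = J}
  one_mem' := by simp
  mul_mem' {a b} ha hb := by
    simp only [Set.mem_ofPred_eq, Units.val_mul, Matrix.transpose_mul] at *
    calc (b : Matrix ι ι K)ᵀ * (a : Matrix ι ι K)ᵀ * J * ((a : Matrix ι ι K) * (b : Matrix ι ι K))
        = (b : Matrix ι ι K)ᵀ * ((a : Matrix ι ι K)ᵀ * J * (a : Matrix ι ι K))
          * (b : Matrix ι ι K) := by simp only [Matrix.mul_assoc]
      _ = J := by rw [ha, hb]
  inv_mem' {a} ha := by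
    simp only [Set.mem_ofPred_eq] at *
    have h1 : (a : Matrix ι ι K) * ((a⁻¹ : GL ι K) : Matrix ι ι K) = 1 := by
      rw [← Units.val_mul, mul_inv_cancel, Units.val_one]
    have h2 : ((a⁻¹ : GL ι K) : Matrix ι ι K)ᵀ * (a : Matrix ι ι K)ᵀ = 1 := by
      rw [← Matrix.transpose_mul, h1, Matrix.transpose_one]
    calc ((a⁻¹ : GL ι K) : Matrix ι ι K)ᵀ * J * ((a⁻¹ : GL ι K) : Matrix ι ι K)
        = ((a⁻¹ : GL ι K) : Matrix ι ι K)ᵀ * ((a : Matrix ι ι K)ᵀ * J * (a : Matrix ι ι K))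
          * ((a⁻¹ : GL ι K) : Matrix ι ι K) := by rw [ha]
      _ = (((a⁻¹ : GL ι K) : Matrix ι ι K)ᵀ * (a : Matrix ι ι K)ᵀ) * J
          * ((a : Matrix ι ι K) * ((a⁻¹ : GL ι K) : Matrix ι ι K)) := by
            simp only [Matrix.mul_assoc]
      _ = J := by rw [h1, h2, Matrix.one_mul, Matrix.mul_one]

end MatrixGroups

/-! ### Spin groups -/

section Spin

variable {K : Type v} [Field K]

/-- The ring `A`, regarded as a `K`-algebra through the ring endomorphism `φ` of `K`. -/
def Twisted (_φ : K →+* K) (A : Type v) : Type v := A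

instance (φ : K →+* K) (A : Type v) [Ring A] : Ring (Twisted φ A) := inferInstanceAs (Ring A)

instance (φ : K →+* K) (A : Type v) [Ring A] [Algebra K A] : Algebra K (Twisted φ A) :=
  RingHom.toAlgebra' (S := Twisted φ A) ((algebraMap K A).comp φ)
    (fun c x => Algebra.commutes (A := A) (φ c) x)

/-- The split (hyperbolic) quadratic form `∑ xᵢ yᵢ` in `2n` variables. -/
def splitForm (K : Type v) [Field K] (n : ℕ) : QuadraticForm K (Fin n ⊕ Fin n → K) :=
  ∑ i : Fin n, QuadraticMap.proj (Sum.inl i) (Sum.inr i)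

theorem splitForm_apply (n : ℕ) (x : Fin n ⊕ Fin n → K) :
    splitForm K n x = ∑ i : Fin n, x (Sum.inl i) * x (Sum.inr i) := by
  simp [splitForm]

/-- The Clifford algebra of the split form. -/
abbrev SplitClifford (K : Type v) [Field K] (n : ℕ) : Type v := CliffordAlgebra (splitForm K n)

/-- The image in the Clifford algebra of the `j`-th standard basis vector. -/
def basisVector (K : Type v) [Field K] (n : ℕ) (j : Fin n ⊕ Fin n) : SplitClifford K n :=
  CliffordAlgebra.ι (splitForm K n) (Pi.single j 1)

/-- The linear map that sends a vector `x` to the vector `φ(x)` of the Clifford algebra. -/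
def frobVector (n : ℕ) (φ : K →+* K) :
    (Fin n ⊕ Fin n → K) →ₗ[K] Twisted φ (SplitClifford K n) where
  toFun x := (CliffordAlgebra.ι (splitForm K n) (fun j => φ (x j)) : SplitClifford K n)
  map_add' x y := by
    have h : (fun j => φ ((x + y) j)) = (fun j => φ (x j)) + fun j => φ (y j) := by
      ext j; simp
    rw [h, map_add]; rfl
  map_smul' c x := by
    have h : (fun j => φ ((c • x) j)) = φ c • fun j => φ (x j) := by
      ext j; simp
    rw [h, map_smul, Algebra.smul_def, RingHom.id_apply]
    exact (Algebra.smul_def (A := Twisted φ (SplitClifford K n)) c _).symm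

/-- The ring endomorphism of the Clifford algebra that applies `φ` to the coordinates with respect
to the standard basis vectors and their products. -/
def cliffordFrob (n : ℕ) (φ : K →+* K) : SplitClifford K n →+* SplitClifford K n :=
  (CliffordAlgebra.lift (splitForm K n) ⟨frobVector n φ, fun x => by
    have h : φ (splitForm K n x) = splitForm K n (fun j => φ (x j)) := by
      simp [splitForm_apply]
    change CliffordAlgebra.ι (splitForm K n) (fun j => φ (x j)) *
      CliffordAlgebra.ι (splitForm K n) (fun j => φ (x j)) =
        algebraMap K (SplitClifford K n) (φ (splitForm K n x))
    rw [CliffordAlgebra.ι_sq_scalar, h]⟩ :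
    SplitClifford K n →ₐ[K] Twisted φ (SplitClifford K n)).toRingHom

theorem cliffordFrob_ι (n : ℕ) (φ : K →+* K) (x : Fin n ⊕ Fin n → K) :
    cliffordFrob n φ (CliffordAlgebra.ι (splitForm K n) x) =
      CliffordAlgebra.ι (splitForm K n) (fun j => φ (x j)) :=
  CliffordAlgebra.lift_ι_apply (A := Twisted φ (SplitClifford K n)) _ _ _

theorem cliffordFrob_algebraMap (n : ℕ) (φ : K →+* K) (c : K) :
    cliffordFrob n φ (algebraMap K (SplitClifford K n) c) =
      algebraMap K (SplitClifford K n) (φ c) :=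
  AlgHom.commutes (CliffordAlgebra.lift (splitForm K n) (A := Twisted φ (SplitClifford K n)) _) c

/-- The spin group of the split form, inside the units of the Clifford algebra. -/
def splitSpin (K : Type v) [Field K] (n : ℕ) : Subgroup (SplitClifford K n)ˣ :=
  { (spinGroup (splitForm K n)).comap (Units.coeHom (SplitClifford K n)) with
    inv_mem' := by
      intro x hx
      have hx' : (x : SplitClifford K n) ∈ spinGroup (splitForm K n) := hx
      have h : ((x⁻¹ : (SplitClifford K n)ˣ) : SplitClifford K n) = star (x : SplitClifford K n) :=
        Units.inv_eq_of_mul_eq_one_right (spinGroup.mul_star_self_of_mem hx')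
      change ((x⁻¹ : (SplitClifford K n)ˣ) : SplitClifford K n) ∈ spinGroup (splitForm K n)
      rw [h]
      exact spinGroup.star_mem hx' }

/-- `x` acts on the `2n`-dimensional quadratic space by `eᵢ ↦ aᵢ eᵢ`, `fᵢ ↦ aᵢ⁻¹ fᵢ`, where
`eᵢ, fᵢ` is the standard hyperbolic basis and the action is `v ↦ x v x⁻¹`. -/
def ActsDiagonally {n : ℕ} (x : (SplitClifford K n)ˣ) (a : Fin n → Kˣ) : Prop :=
  ∀ i, (x : SplitClifford K n) * basisVector K n (Sum.inl i) * ((x⁻¹ : (SplitClifford K n)ˣ)) =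
      (a i : K) • basisVector K n (Sum.inl i) ∧
    (x : SplitClifford K n) * basisVector K n (Sum.inr i) * ((x⁻¹ : (SplitClifford K n)ˣ)) =
      ((a i)⁻¹ : K) • basisVector K n (Sum.inr i)

/-- The vectors of the quadratic space embed into the Clifford algebra (in any characteristic). -/
theorem ι_splitForm_injective (K : Type v) [Field K] (n : ℕ) :
    Function.Injective (CliffordAlgebra.ι (splitForm K n)) := by
  let B : LinearMap.BilinForm K (Fin n ⊕ Fin n → K) :=
    -∑ i : Fin n, LinearMap.BilinForm.linMulLin
      (LinearMap.proj (R := K) (φ := fun _ => K) (Sum.inl i : Fin n ⊕ Fin n))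
      (LinearMap.proj (R := K) (φ := fun _ => K) (Sum.inr i : Fin n ⊕ Fin n))
  have hB : B.toQuadraticMap = 0 - splitForm K n := by
    ext x
    simp [B, splitForm_apply, LinearMap.BilinForm.linMulLin]
  intro x y hxy
  have h := congrArg (CliffordAlgebra.changeForm hB) hxy
  rw [CliffordAlgebra.changeForm_ι, CliffordAlgebra.changeForm_ι] at h
  exact ExteriorAlgebra.ι_leftInverse.injective h

theorem basisVector_ne_zero (n : ℕ) (j : Fin n ⊕ Fin n) : basisVector K n j ≠ 0 := by
  intro h
  have h' := ι_splitForm_injective K n (h.trans (map_zero _).symm)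
  simpa using congrFun h' j

theorem ActsDiagonally.unique {n : ℕ} {x : (SplitClifford K n)ˣ} {a b : Fin n → Kˣ}
    (ha : ActsDiagonally x a) (hb : ActsDiagonally x b) : a = b := by
  funext i
  exact Units.ext (smul_left_injective K (basisVector_ne_zero n (Sum.inl i))
    ((ha i).1.symm.trans (hb i).1))

theorem ActsDiagonally.one {n : ℕ} : ActsDiagonally (1 : (SplitClifford K n)ˣ) 1 := by
  intro i; simp

theorem ActsDiagonally.mul {n : ℕ} {x y : (SplitClifford K n)ˣ} {a b : Fin n → Kˣ}
    (ha : ActsDiagonally x a) (hb : ActsDiagonally y b) : ActsDiagonally (x * y) (a * b) := by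
  have key : ∀ (v : SplitClifford K n) (c d : K),
      (x : SplitClifford K n) * v * ((x⁻¹ : (SplitClifford K n)ˣ)) = c • v →
      (y : SplitClifford K n) * v * ((y⁻¹ : (SplitClifford K n)ˣ)) = d • v →
      ((x * y : (SplitClifford K n)ˣ) : SplitClifford K n) * v *
        (((x * y)⁻¹ : (SplitClifford K n)ˣ)) = (c * d) • v := by
    intro v c d hc hd
    calc ((x * y : (SplitClifford K n)ˣ) : SplitClifford K n) * v *
          (((x * y)⁻¹ : (SplitClifford K n)ˣ))
        = (x : SplitClifford K n) * ((y : SplitClifford K n) * v *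
            ((y⁻¹ : (SplitClifford K n)ˣ))) * ((x⁻¹ : (SplitClifford K n)ˣ)) := by
          simp only [mul_inv_rev, Units.val_mul, mul_assoc]
      _ = (c * d) • v := by
          rw [hd, mul_smul_comm, smul_mul_assoc, hc, smul_smul, mul_comm]
  intro i
  refine ⟨by simpa using key _ _ _ (ha i).1 (hb i).1, ?_⟩
  have := key _ _ _ (ha i).2 (hb i).2
  simpa [mul_comm] using this

theorem ActsDiagonally.inv {n : ℕ} {x : (SplitClifford K n)ˣ} {a : Fin n → Kˣ}
    (ha : ActsDiagonally x a) : ActsDiagonally x⁻¹ a⁻¹ := by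
  have key : ∀ (v : SplitClifford K n) (c : K), c ≠ 0 →
      (x : SplitClifford K n) * v * ((x⁻¹ : (SplitClifford K n)ˣ)) = c • v →
      ((x⁻¹ : (SplitClifford K n)ˣ) : SplitClifford K n) * v *
        (((x⁻¹)⁻¹ : (SplitClifford K n)ˣ)) = c⁻¹ • v := by
    intro v c hc h
    have h2 : v = c • (((x⁻¹ : (SplitClifford K n)ˣ) : SplitClifford K n) * v * x) := by
      rw [← smul_mul_assoc, ← mul_smul_comm, ← h]
      simp [mul_assoc]
    rw [inv_inv]
    rw [eq_inv_smul_iff₀ hc]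
    exact h2.symm
  intro i
  have h1 := key _ _ (Units.ne_zero (a i)) (ha i).1
  have h2 := key _ _ (inv_ne_zero (Units.ne_zero (a i))) (ha i).2
  exact ⟨by simpa using h1, by simpa using h2⟩

/-- The reference torus of the spin group: the elements that act diagonally, with mutually inverse
eigenvalues on `eᵢ` and `fᵢ`; this is the preimage of the diagonal torus of the orthogonal group. -/
def spinTorus (K : Type v) [Field K] (n : ℕ) : Subgroup (SplitClifford K n)ˣ where
  carrier := {x | x ∈ splitSpin K n ∧ ∃ a, ActsDiagonally x a}
  one_mem' := ⟨one_mem _, 1, ActsDiagonally.one⟩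
  mul_mem' := by
    rintro x y ⟨hx, a, ha⟩ ⟨hy, b, hb⟩
    exact ⟨mul_mem hx hy, a * b, ha.mul hb⟩
  inv_mem' := by
    rintro x ⟨hx, a, ha⟩
    exact ⟨inv_mem hx, a⁻¹, ha.inv⟩

/-- The weight `εⱼ` of the torus of the spin group: the eigenvalue on `eⱼ`. -/
def spinWeight {n : ℕ} (j : Fin n) : spinTorus K n →* Kˣ where
  toFun x := x.2.2.choose j
  map_one' := by
    rw [(Exists.choose_spec (1 : spinTorus K n).2.2).unique ActsDiagonally.one]; rfl
  map_mul' x y := by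
    rw [(Exists.choose_spec (x * y).2.2).unique
      ((Exists.choose_spec x.2.2).mul (Exists.choose_spec y.2.2))]; rfl

/-- The split spin group with its Frobenius map, torus and weights. -/
def spinGroupWithTorus (n : ℕ) (φ : K →+* K) : GroupWithTorus K n where
  Amb := (SplitClifford K n)ˣ
  G := splitSpin K n
  frob := Units.map (cliffordFrob n φ : SplitClifford K n →* SplitClifford K n)
  torus := spinTorus K n
  torus_le := fun _ hx => hx.1
  ε := spinWeight

end Spin

/-! ### The classical groups -/

/-- The families `GL_n`, `SL_{n+1}`, `Sp_{2n}`, `SO_{2n+1}`, `SO_{2n}^+`, `Spin_{2n}^+`. -/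
inductive ClassicalFamily
  | generalLinear
  | specialLinear
  | symplectic
  | oddOrthogonal
  | plusOrthogonal
  | plusSpin

namespace ClassicalFamily

/-- The orthogonal groups are considered for odd `q`, the spin groups for even `q`. -/
def Admissible (q : ℕ) : ClassicalFamily → Prop
  | .generalLinear => True
  | .specialLinear => True
  | .symplectic => True
  | .oddOrthogonal => Odd q
  | .plusOrthogonal => Odd q
  | .plusSpin => Even q

/-- The Frobenius map `x ↦ x ^ q` of a field extension `K` of the field `F` of `q` elements. -/
def frobenius (F : Type u) [Field F] [Fintype F] (K : Type v) [Field K] [Algebra F K] : K →+* K :=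
  (FiniteField.frobeniusAlgHom F K).toRingHom

/-- The algebraic group of a given family over an algebraic closure `K` of the finite field `F`,
with the split Frobenius map over `F`, and with the weights `ε₁, …, εₙ` of the reference torus. -/
def toGroup (F : Type u) [Field F] [Fintype F] (K : Type v) [Field K] [Algebra F K] (n : ℕ) :
    ClassicalFamily → GroupWithTorus K n
  | .generalLinear => matrixGroupWithTorus (ι := Fin n) (frobenius F K) ⊤ id
  | .specialLinear => matrixGroupWithTorus (frobenius F K) (_root_.specialLinear (Fin (n + 1)) K) Fin.castSucc
  | .symplectic => matrixGroupWithTorus (frobenius F K) (isometryGroup (Matrix.J (Fin n) K)) Sum.inl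
  | .oddOrthogonal => matrixGroupWithTorus (frobenius F K)
      (isometryGroup (LieAlgebra.Orthogonal.JB (Fin n) K) ⊓
        _root_.specialLinear (Unit ⊕ Fin n ⊕ Fin n) K) (fun i => Sum.inr (Sum.inl i))
  | .plusOrthogonal => matrixGroupWithTorus (frobenius F K)
      (isometryGroup (LieAlgebra.Orthogonal.JD (Fin n) K) ⊓
        _root_.specialLinear (Fin n ⊕ Fin n) K) Sum.inl
  | .plusSpin => spinGroupWithTorus n (frobenius F K)

end ClassicalFamily

end

noncomputable section

/-! ### Digit sums -/

/-! Both counts equal the number of weights in the orbit of `ωᵢ` that are fixed by `w`, which is the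
value at `w` of the permutation character on `W / Wᵢ`, that is, of the induced trivial character
(`inducedCharacter_stabilizer`).

Conjugation by `x` identifies `T_w` with the fixed points in `T` of `φ(t) = m F(t) m⁻¹`, where `m =
x⁻¹ F(x)` represents `w` (`transport_apply_iff`). Since `F` raises weights to their `q`-th powers,
`χ(φ(t)) = (w⁻¹χ)(t)^q`. Hence `wχ = χ` forces `χ(t) = χ(t)^q` on fixed points, so that `χ^(q-1)` is
trivial on `T_w`.

The converse is `smul_eq_self_of_pow_eq_one`. Take `N` with `w^N = 1`, a root of unity `ζ` of order
`q^N - 1` and a one-parameter subgroup `γ` of `T`. The norm `∏_{k<N} φ^k(γ(ζ))` is a fixed point of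
`φ`, and `χ` takes on it the value `ζ^(∑ aₖ q^k)`, where `aₖ` is the pairing of `w⁻ᵏχ` with `γ`. If
`χ^(q-1)` is trivial there, then `q^N - 1` divides `(q-1) ∑ aₖ q^k`. The weights in question are
products of distinct diagonal entries, so all `aₖ` lie in `{-1, 0, 1}`, and such digits must all
coincide (`digits_eq_of_dvd_sum`). Thus `w⁻¹χ` and `χ` pair equally with `γ`; enough subgroups `γ`
are available to conclude `w⁻¹χ = χ`.

For the count with `μ`, raising to the power `q - 1` is injective on these weights; for the count
with values in the field of `q` elements, its units are exactly the roots of `x^(q-1) = 1`.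

The argument is uniform once a group has a `SplitTorusModel`. For matrix groups this is read off
from the diagonal matrices. For the spin group in characteristic two the vector representation is
faithful, and square roots in `K` supply the one-parameter subgroups. -/

theorem digits_eq_zero_of_sum_eq_zero {q : ℤ} (hq : 2 ≤ q) (N : ℕ) (a : ℕ → ℤ)
    (ha : ∀ k, |a k| ≤ 1) (h : ∑ k ∈ Finset.range N, a k * q ^ k = 0) : ∀ k < N, a k = 0 := by
  induction N generalizing a with
  | zero => intro k hk; omega
  | succ N ih =>
    have hs : ∑ k ∈ Finset.range (N + 1), a k * q ^ k =
        q * (∑ k ∈ Finset.range N, a (k + 1) * q ^ k) + a 0 := by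
      rw [Finset.sum_range_succ', Finset.mul_sum]
      congr 1
      · exact Finset.sum_congr rfl fun k _ => by ring
      · simp
    rw [hs] at h
    -- Modulo `q` only the lowest digit survives, and `|a 0| ≤ 1 < q`.
    have h0 : a 0 = 0 := by
      have hd : q ∣ a 0 := ⟨-(∑ k ∈ Finset.range N, a (k + 1) * q ^ k), by linarith⟩
      exact Int.eq_zero_of_abs_lt_dvd hd (lt_of_le_of_lt (ha 0) (by omega))
    have h1 : ∑ k ∈ Finset.range N, a (k + 1) * q ^ k = 0 := by
      rw [h0, add_zero] at h
      exact (mul_eq_zero.1 h).resolve_left (by omega)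
    intro k hk
    cases k with
    | zero => exact h0
    | succ k => exact ih (fun k => a (k + 1)) (fun k => ha _) h1 k (by omega)

/-- After cancelling `q - 1`, the repunit `R = 1 + q + ⋯ + q^(N-1)` divides a digit sum of absolute
value at most `R`, so the sum is `-R`, `0` or `R`. -/
theorem digits_eq_of_dvd_sum {q : ℤ} (hq : 2 ≤ q) (N : ℕ) (a : ℕ → ℤ) (ha : ∀ k, |a k| ≤ 1)
    (h : q ^ N - 1 ∣ (q - 1) * ∑ k ∈ Finset.range N, a k * q ^ k) :
    ∀ k < N, ∀ l < N, a k = a l := by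
  rcases Nat.eq_zero_or_pos N with rfl | hN
  · intro k hk; omega
  set R : ℤ := ∑ k ∈ Finset.range N, q ^ k with hR
  have hRpos : 0 < R := Finset.sum_pos (fun k _ => by positivity) ⟨0, by simpa using hN⟩
  rw [← mul_geom_sum, mul_dvd_mul_iff_left (by omega)] at h
  obtain ⟨c, hc⟩ := h
  rw [← hR] at hc
  have hle : |R * c| ≤ R := by
    rw [← hc]
    refine (Finset.abs_sum_le_sum_abs _ _).trans (Finset.sum_le_sum fun k _ => ?_)
    rw [abs_mul, abs_of_nonneg (by positivity : (0 : ℤ) ≤ q ^ k)]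
    exact mul_le_of_le_one_left (by positivity) (ha k)
  have hc1 : |c| ≤ 1 := by
    rw [abs_mul, abs_of_pos hRpos] at hle
    nlinarith
  have key : ∀ k < N, a k = c := by
    have hsum : ∑ k ∈ Finset.range N, (a k - c) * q ^ k = 0 := by
      simp only [sub_mul, Finset.sum_sub_distrib, ← Finset.mul_sum]
      rw [hc, ← hR]; ring
    obtain ⟨hc1, hc2⟩ := abs_le.1 hc1
    have hcases : c = -1 ∨ c = 0 ∨ c = 1 := by omega
    -- For `c = ±1` the digits `a k - c` can have absolute value `2`, too large for uniqueness of
    -- digits when `q = 2`; but they all have the same sign, so each term of the vanishing sum is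
    -- zero.
    rcases hcases with rfl | rfl | rfl
    · intro k hk
      have := (Finset.sum_eq_zero_iff_of_nonneg (fun k _ => mul_nonneg
        (by linarith [(abs_le.1 (ha k)).1] : (0 : ℤ) ≤ a k - -1) (by positivity))).1 hsum k
        (Finset.mem_range.2 hk)
      have := (mul_eq_zero.1 this).resolve_right (by positivity)
      omega
    · exact digits_eq_zero_of_sum_eq_zero hq N a ha (by simpa using hsum)
    · have hsum' : ∑ k ∈ Finset.range N, (1 - a k) * q ^ k = 0 := by
        rw [← neg_eq_zero, ← Finset.sum_neg_distrib, ← hsum]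
        exact Finset.sum_congr rfl fun k _ => by ring
      intro k hk
      have := (Finset.sum_eq_zero_iff_of_nonneg (fun k _ => mul_nonneg
        (by linarith [(abs_le.1 (ha k)).2] : (0 : ℤ) ≤ 1 - a k) (by positivity))).1 hsum' k
        (Finset.mem_range.2 hk)
      have := (mul_eq_zero.1 this).resolve_right (by positivity)
      omega
  intro k hk l hl
  rw [key k hk, key l hl]

/-! ### Induced trivial characters -/

/-- The element `g⁻¹wg` stabilizes `a` exactly when `w` fixes `ga`, and each point of the orbit is
`ga` for as many `g` as the stabilizer has elements. -/
theorem inducedCharacter_stabilizer {W α : Type*} [Group W] [Finite W] [MulAction W α] (a : α)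
    (w : W) : inducedCharacter (MulAction.stabilizer W a) (fun _ => 1) w =
      (({χ ∈ MulAction.orbit W a | w • χ = χ}.ncard : ℕ) : ℂ) := by
  classical
  have := Fintype.ofFinite W
  set S : Finset W := Finset.univ.filter fun g => w • g • a = g • a with hS
  have hmem : ∀ g : W, g⁻¹ * w * g ∈ MulAction.stabilizer W a ↔ w • g • a = g • a := by
    intro g
    rw [MulAction.mem_stabilizer_iff, mul_smul, mul_smul, inv_smul_eq_iff]
  have hsum : inducedCharacter (MulAction.stabilizer W a) (fun _ => 1) w =
      (Nat.card (MulAction.stabilizer W a) : ℂ)⁻¹ * S.card := by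
    rw [inducedCharacter, finsum_eq_sum_of_fintype, hS, Finset.card_filter]
    push_cast
    congr 1
    refine Finset.sum_congr rfl fun g _ => ?_
    by_cases h : w • g • a = g • a
    · rw [dif_pos ((hmem g).2 h), if_pos h]
    · rw [dif_neg fun h' => h ((hmem g).1 h'), if_neg h]
  have himage : ((S.image (· • a) : Finset α) : Set α) =
      {χ ∈ MulAction.orbit W a | w • χ = χ} := by
    ext χ
    simp only [hS, Finset.coe_image, Finset.coe_filter, Finset.mem_univ, true_and, Set.mem_image,
      Set.mem_ofPred_eq, MulAction.mem_orbit_iff]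
    constructor
    · rintro ⟨g, hg, rfl⟩; exact ⟨⟨g, rfl⟩, hg⟩
    · rintro ⟨⟨g, rfl⟩, hg⟩; exact ⟨g, hg, rfl⟩
  have hfib : ∀ χ ∈ S.image (· • a), (S.filter fun g => g • a = χ).card =
      Nat.card (MulAction.stabilizer W a) := by
    intro χ hχ
    obtain ⟨g, hg, rfl⟩ := Finset.mem_image.1 hχ
    rw [Nat.card_eq_fintype_card, Fintype.card_subtype]
    refine (Finset.card_bij (fun h _ => g * h) ?_ ?_ ?_).symm
    · intro h hh
      have hh' : h • a = a := by simpa using hh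
      have hg' : w • g • a = g • a := by simpa [hS] using hg
      simp [hS, mul_smul, hh', hg']
    · intro h _ h' _ e; exact mul_left_cancel e
    · intro h hh
      refine ⟨g⁻¹ * h, ?_, by simp⟩
      have hh' := (Finset.mem_filter.1 hh).2
      simpa [mul_smul, inv_smul_eq_iff] using hh'
  have hmaps : Set.MapsTo (· • a) (S : Set W) (S.image (· • a) : Finset α) :=
    fun g hg => Finset.mem_coe.2 (Finset.mem_image_of_mem (· • a) hg)
  have hcard := Finset.card_eq_sum_card_fiberwise hmaps
  rw [Finset.sum_congr rfl hfib, Finset.sum_const, smul_eq_mul] at hcard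
  rw [hsum, hcard, ← himage, Set.ncard_coe_finset]
  have h0 : (Nat.card (MulAction.stabilizer W a) : ℂ) ≠ 0 :=
    Nat.cast_ne_zero.2 Nat.card_pos.ne'
  push_cast
  field_simp

/-! ### Diagonal matrices -/

section

variable {K : Type v} [Field K] {ι : Type} [Fintype ι] [DecidableEq ι]

theorem mem_diagonalSubgroup_of_offDiag {g : GL ι K}
    (hg : ∀ k j, k ≠ j → (g : Matrix ι ι K) k j = 0) : g ∈ diagonalSubgroup ι K := by
  have hd : (g : Matrix ι ι K) = Matrix.diagonal fun k => (g : Matrix ι ι K) k k := by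
    ext k j
    rcases eq_or_ne k j with rfl | h
    · simp
    · rw [hg k j h, Matrix.diagonal_apply_ne _ h]
  have hne : ∀ k, (g : Matrix ι ι K) k k ≠ 0 := by
    intro k hk
    have h := congrFun (congrFun (Units.mul_inv g) k) k
    rw [hd, Matrix.diagonal_mul, hk, zero_mul, Matrix.one_apply_eq] at h
    exact zero_ne_one h
  refine ⟨MulEquiv.piUnits.symm fun k => Units.mk0 _ (hne k), ?_⟩
  ext1
  exact hd.symm

theorem coe_diagonalEntry (j : ι) (t : diagonalSubgroup ι K) :
    (diagonalEntry j t : K) = ((t : GL ι K) : Matrix ι ι K) j j := rfl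

theorem eq_diagonal_diagonalEntry (t : diagonalSubgroup ι K) :
    ((t : GL ι K) : Matrix ι ι K) = Matrix.diagonal fun j => (diagonalEntry j t : K) := by
  obtain ⟨d, hd⟩ := mem_diagonalSubgroup t.2
  simp [coe_diagonalEntry, hd]

end

/-! ### Generalities on the Weyl group action -/

namespace GroupWithTorus

variable {K : Type v} [Field K] {n : ℕ} (D : GroupWithTorus K n)

theorem toWeyl_surjective : Function.Surjective D.toWeyl :=
  QuotientGroup.mk'_surjective _

theorem toWeyl_eq_one_iff (m : D.normalizer) : D.toWeyl m = 1 ↔ (m : D.Amb) ∈ D.torus :=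
  QuotientGroup.eq_one_iff (N := D.torusInNormalizer) m

theorem smul_prod {α : Type*} (g : D.Weyl) (A : Finset α) (f : α → D.torus →* Kˣ) :
    g • ∏ k ∈ A, f k = ∏ k ∈ A, g • f k := by
  obtain ⟨m, rfl⟩ := D.toWeyl_surjective g
  ext t
  simp [toWeyl_smul_apply, MonoidHom.finsetProd_apply]

theorem smul_pow_character (g : D.Weyl) (χ : D.torus →* Kˣ) (k : ℕ) :
    g • χ ^ k = (g • χ) ^ k := by
  obtain ⟨m, rfl⟩ := D.toWeyl_surjective g
  ext t
  simp [toWeyl_smul_apply]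

theorem transport_injective (x : D.Amb) : Function.Injective (D.transport x) := by
  intro χ χ' h
  ext t
  have ht : x * t * x⁻¹ ∈ D.conjugateTorus x := ⟨t, t.2, rfl⟩
  have := DFunLike.congr_fun h ⟨_, ht⟩
  simpa [transport, mul_assoc] using congrArg Units.val this

end GroupWithTorus

/-! ### Diagonal models and the action of the Weyl group on their weights -/

/-- A faithful representation of `D.G` for which the reference torus consists of the elements
acting by diagonal matrices. -/
structure DiagonalModel {K : Type v} [Field K] {n : ℕ} (D : GroupWithTorus K n)
    (ι : Type) [Fintype ι] [DecidableEq ι] where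
  /-- the representation -/
  ρ : D.G →* GL ι K
  injective : Function.Injective ρ
  mem_torus_iff : ∀ g : D.G, (g : D.Amb) ∈ D.torus ↔ ρ g ∈ diagonalSubgroup ι K

namespace DiagonalModel

variable {K : Type v} [Field K] {n : ℕ} {D : GroupWithTorus K n}
  {ι : Type} [Fintype ι] [DecidableEq ι] (M : DiagonalModel D ι)

/-- The reference torus as a group of diagonal matrices. -/
def toDiagonal : D.torus →* diagonalSubgroup ι K :=
  (M.ρ.comp (Subgroup.inclusion D.torus_le)).codRestrict _ fun t =>
    (M.mem_torus_iff _).1 t.2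

/-- The weight of the reference torus on the `k`-th basis vector. -/
def entry (k : ι) : D.torus →* Kˣ := (diagonalEntry k).comp M.toDiagonal

theorem coe_ρ_torus (t : D.torus) :
    (M.ρ ⟨t, D.torus_le t.2⟩ : Matrix ι ι K) = Matrix.diagonal fun k => (M.entry k t : K) :=
  eq_diagonal_diagonalEntry (M.toDiagonal t)

theorem torus_ext {s t : D.torus} (h : ∀ k, M.entry k s = M.entry k t) : s = t := by
  have h1 : M.ρ ⟨s, D.torus_le s.2⟩ = M.ρ ⟨t, D.torus_le t.2⟩ := by
    ext1
    rw [coe_ρ_torus, coe_ρ_torus]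
    simp only [h]
  exact Subtype.ext (congrArg (fun g : D.G => (g : D.Amb)) (M.injective h1))

theorem torus_comm (M : DiagonalModel D ι) (s t : D.torus) : s * t = t * s :=
  M.torus_ext fun k => by rw [map_mul, map_mul, mul_comm]

/-- The reference torus is commutative. -/
@[reducible] def commGroup (M : DiagonalModel D ι) : CommGroup D.torus :=
  { (inferInstance : Group D.torus) with mul_comm := M.torus_comm }

/-- Compare the `(k, j)` coefficients in `t m = m (m⁻¹ t m)`: both sides contain the factor `m k j`,
which cancels. -/
theorem smul_entry_of_ne_zero (m : D.normalizer) {j k : ι}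
    (h : (M.ρ ⟨m, (Subgroup.mem_inf.1 m.2).1⟩ : Matrix ι ι K) k j ≠ 0) :
    D.toWeyl m • M.entry j = M.entry k := by
  ext t
  have h1 : (⟨t, D.torus_le t.2⟩ : D.G) * ⟨m, (Subgroup.mem_inf.1 m.2).1⟩ =
      ⟨m, (Subgroup.mem_inf.1 m.2).1⟩ *
        ⟨D.conjTorus m t, D.torus_le (D.conjTorus m t).2⟩ := by
    ext1
    simp [GroupWithTorus.conjTorus, mul_assoc]
  have h2 := congrArg (fun g : GL ι K => (g : Matrix ι ι K) k j) (congrArg M.ρ h1)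
  simp only [map_mul, Units.val_mul, coe_ρ_torus, Matrix.diagonal_mul, Matrix.mul_diagonal] at h2
  rw [mul_comm] at h2
  exact (mul_left_cancel₀ h h2).symm

/-- Column `j` of an invertible matrix has a nonzero entry. -/
theorem exists_smul_entry (g : D.Weyl) (j : ι) : ∃ k, g • M.entry j = M.entry k := by
  obtain ⟨m, rfl⟩ := D.toWeyl_surjective g
  by_contra! hne
  set g := M.ρ ⟨m, (Subgroup.mem_inf.1 m.2).1⟩ with hg
  have h0 : ∀ k, (g : Matrix ι ι K) k j = 0 := fun k => by
    by_contra h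
    exact hne k (M.smul_entry_of_ne_zero m h)
  have h := congrFun (congrFun (Units.inv_mul g) j) j
  rw [Matrix.mul_apply, Matrix.one_apply_eq] at h
  simp [h0] at h

/-- A nonzero off-diagonal coefficient would move one weight to a different one, so a representative
is diagonal and lies in the torus. -/
theorem weyl_eq_one_of_smul_entry (hM : Function.Injective M.entry) {g : D.Weyl}
    (h : ∀ j, g • M.entry j = M.entry j) : g = 1 := by
  obtain ⟨m, rfl⟩ := D.toWeyl_surjective g
  rw [D.toWeyl_eq_one_iff]
  refine (M.mem_torus_iff ⟨m, (Subgroup.mem_inf.1 m.2).1⟩).2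
    (mem_diagonalSubgroup_of_offDiag fun k j hkj => ?_)
  by_contra hne
  exact hkj (hM ((M.smul_entry_of_ne_zero m hne).symm.trans (h j)))

theorem finite_weyl (hM : Function.Injective M.entry) : Finite D.Weyl := by
  choose σ hσ using M.exists_smul_entry
  refine Finite.of_injective σ fun g h hgh => ?_
  rw [← inv_mul_eq_one]
  refine M.weyl_eq_one_of_smul_entry hM fun j => ?_
  rw [mul_smul, inv_smul_eq_iff, hσ, hσ, hgh]

/-- The Weyl group permutes the diagonal weights, so a product over distinct positions stays one.
This keeps the exponents on one-parameter subgroups within `{-1, 0, 1}` along the whole orbit of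
`ωᵢ`. -/
theorem exists_smul_prod_entry (hM : Function.Injective M.entry) (g : D.Weyl) (A : Finset ι) :
    ∃ A' : Finset ι, g • ∏ k ∈ A, M.entry k = ∏ k ∈ A', M.entry k := by
  choose σ hσ using M.exists_smul_entry g
  have hinj : Function.Injective σ := fun j k hjk =>
    hM (MulAction.injective g (by simp only [hσ, hjk]))
  refine ⟨A.map ⟨σ, hinj⟩, ?_⟩
  rw [D.smul_prod, Finset.prod_map]
  exact Finset.prod_congr rfl fun k _ => hσ k

end DiagonalModel

/-! ### Split torus models and the count of weights -/

theorem prod_zpow_eq_zpow_sum {G α : Type*} [CommGroup G] (s : G) (A : Finset α) (f : α → ℤ) :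
    ∏ k ∈ A, s ^ f k = s ^ ∑ k ∈ A, f k := by
  classical
  induction A using Finset.induction_on with
  | empty => simp
  | insert a A ha ih => rw [Finset.prod_insert ha, Finset.sum_insert ha, zpow_add, ih]

/-- A diagonal model in which the Frobenius map raises weights to their `q`-th powers, together with
one-parameter subgroups of the torus on which sums of distinct weights have exponents `0, ±1`. -/
structure SplitTorusModel {K : Type v} [Field K] {n : ℕ} (D : GroupWithTorus K n) (q : ℕ)
    (ι B : Type) [Fintype ι] [DecidableEq ι] [Fintype B] extends DiagonalModel D ι where
  frob_mem : ∀ t ∈ D.torus, D.frob t ∈ D.torus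
  entry_frob : ∀ (k : ι) (t : D.torus),
    toDiagonalModel.entry k ⟨D.frob t, frob_mem t t.2⟩ = toDiagonalModel.entry k t ^ q
  /-- the positions of the distinguished weights -/
  c : Fin n → ι
  c_injective : Function.Injective c
  ε_eq : ∀ j, D.ε j = toDiagonalModel.entry (c j)
  /-- the one-parameter subgroups -/
  γ : B → Kˣ →* D.torus
  /-- the pairing of weights and one-parameter subgroups -/
  p : B → ι → ℤ
  entry_γ : ∀ b k s, toDiagonalModel.entry k (γ b s) = s ^ p b k
  abs_sum_p_le : ∀ b (A : Finset ι), |∑ k ∈ A, p b k| ≤ 1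
  eq_of_p_eq : ∀ k l, (∀ b, p b k = p b l) → k = l
  /-- weights that are coordinates dual to the one-parameter subgroups -/
  d : B → ι
  prod_entry_d : ∀ (t : D.torus) k,
    ∏ b, toDiagonalModel.entry (d b) t ^ p b k = toDiagonalModel.entry k t

namespace SplitTorusModel

variable {K : Type v} [Field K] {n : ℕ} {D : GroupWithTorus K n} {q : ℕ}
  {ι B : Type} [Fintype ι] [DecidableEq ι] [Fintype B] (M : SplitTorusModel D q ι B)

theorem prod_entry_γ (A : Finset ι) (b : B) (s : Kˣ) :
    (∏ k ∈ A, M.entry k) (M.γ b s) = s ^ ∑ k ∈ A, M.p b k := by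
  rw [MonoidHom.finsetProd_apply]
  simp only [M.entry_γ]
  exact prod_zpow_eq_zpow_sum _ _ _

/-- The one-parameter subgroups generate the torus: by `prod_entry_d`, `t` is the product of the
elements `γ b` evaluated at the coordinates `d b` of `t`. -/
theorem character_ext {χ χ' : D.torus →* Kˣ} (h : ∀ b s, χ (M.γ b s) = χ' (M.γ b s)) :
    χ = χ' := by
  let _ : CommGroup D.torus := M.commGroup
  ext1 t
  have ht : t = ∏ b, M.γ b (M.entry (M.d b) t) := by
    refine M.torus_ext fun k => ?_
    rw [map_prod]
    simp only [M.entry_γ, M.prod_entry_d]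
  rw [ht, map_prod, map_prod]
  exact Finset.prod_congr rfl fun b _ => h b _

/-- In `K` the integer `q ^ N - 1` equals `-1`, so it is prime to the characteristic and primitive
roots of this order exist. -/
theorem exists_orderOf_eq [IsAlgClosed K] (hq : (q : K) = 0) (hq2 : 2 ≤ q) {N : ℕ} (hN : N ≠ 0) :
    ∃ ζ : Kˣ, orderOf ζ = q ^ N - 1 := by
  have hqN : 1 ≤ q ^ N := Nat.one_le_pow _ _ (by omega)
  have hne : NeZero ((q ^ N - 1 : ℕ) : K) := ⟨by simp [Nat.cast_sub hqN, hq, hN]⟩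
  obtain ⟨ζ, hζ⟩ := HasEnoughRootsOfUnity.exists_primitiveRoot K (q ^ N - 1)
  have h0 : q ^ N - 1 ≠ 0 := by have := Nat.one_lt_pow hN hq2; omega
  refine ⟨(hζ.isUnit h0).unit, ?_⟩
  rw [← orderOf_units, IsUnit.unit_spec, hζ.eq_orderOf]

theorem entry_injective [IsAlgClosed K] (hq : (q : K) = 0) (hq2 : 2 ≤ q) :
    Function.Injective M.entry := by
  intro k l hkl
  refine M.eq_of_p_eq k l fun b => ?_
  -- Two exponents differ by at most `2`, less than `q² - 1 ≥ 3`; the order `q - 1` would be too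
  -- small for `q = 2, 3`.
  obtain ⟨ζ, hζ⟩ := exists_orderOf_eq (K := K) hq hq2 (N := 2) (by omega)
  have h := DFunLike.congr_fun hkl (M.γ b ζ)
  rw [M.entry_γ, M.entry_γ, zpow_eq_zpow_iff_modEq, Int.modEq_iff_dvd, hζ] at h
  have hk := M.abs_sum_p_le b {k}
  have hl := M.abs_sum_p_le b {l}
  rw [Finset.sum_singleton, abs_le] at hk hl
  have h4 : 4 ≤ q ^ 2 := by nlinarith
  have := Int.eq_zero_of_abs_lt_dvd h (by rw [abs_lt]; omega)
  omega

/-- The Frobenius map of the reference torus. -/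
def frobTorus : D.torus →* D.torus where
  toFun t := ⟨D.frob t, M.frob_mem t t.2⟩
  map_one' := by ext; simp
  map_mul' s t := by ext; simp

theorem prod_entry_frobTorus (A : Finset ι) (t : D.torus) :
    (∏ k ∈ A, M.entry k) (M.frobTorus t) = (∏ k ∈ A, M.entry k) t ^ q := by
  rw [MonoidHom.finsetProd_apply, MonoidHom.finsetProd_apply, ← Finset.prod_pow]
  exact Finset.prod_congr rfl fun k _ => M.entry_frob k t

/-- The Frobenius map followed by conjugation by `m`. -/
def twistedFrob (m : D.normalizer) : D.torus →* D.torus :=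
  (D.conjTorus m⁻¹).comp M.frobTorus

/-- Each application of the twisted Frobenius map replaces `χ` by `w⁻¹χ` and raises to the power
`q`. The hypothesis is imposed on all conjugates of `χ` because the iteration passes through them.
-/
theorem apply_twistedFrob_iterate {m : D.normalizer} {χ : D.torus →* Kˣ}
    (hχ : ∀ (g : D.Weyl) t, (g • χ) (M.frobTorus t) = (g • χ) t ^ q) (k : ℕ) (t : D.torus) :
    χ ((M.twistedFrob m)^[k] t) = ((D.toWeyl m)⁻¹ ^ k • χ) t ^ q ^ k := by
  induction k generalizing t with
  | zero => simp
  | succ k ih =>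
    rw [Function.iterate_succ_apply, ih, pow_succ' q, pow_mul, ← hχ, pow_succ' _ k, mul_smul,
      ← map_inv, D.toWeyl_smul_apply]
    rfl

theorem smul_prod_entry_frobTorus (hM : Function.Injective M.entry) (A : Finset ι) (g : D.Weyl)
    (t : D.torus) :
    (g • ∏ k ∈ A, M.entry k) (M.frobTorus t) = (g • ∏ k ∈ A, M.entry k) t ^ q := by
  obtain ⟨A', h⟩ := M.exists_smul_prod_entry hM g A
  rw [h]
  exact M.prod_entry_frobTorus A' t

theorem smul_eq_self_of_pow_eq_one [IsAlgClosed K] (hq : (q : K) = 0) (hq2 : 2 ≤ q)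
    (m : D.normalizer) (A : Finset ι)
    (h : ∀ t, M.twistedFrob m t = t → (∏ k ∈ A, M.entry k) t ^ (q - 1) = 1) :
    D.toWeyl m • ∏ k ∈ A, M.entry k = ∏ k ∈ A, M.entry k := by
  have hM := M.entry_injective hq hq2
  have := M.finite_weyl hM
  let _ : CommGroup D.torus := M.commGroup
  set χ := ∏ k ∈ A, M.entry k with hχ
  set w := D.toWeyl m with hw
  -- The factor `2` ensures `N ≥ 2` even for a trivial Weyl group, so that the digits at positions
  -- `0` and `1` both exist.
  set N := 2 * Nat.card D.Weyl with hN
  have hN2 : 2 ≤ N := by have := Nat.card_pos (α := D.Weyl); omega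
  have hwN : w⁻¹ ^ N = 1 := by rw [hN, mul_comm, pow_mul, pow_card_eq_one', one_pow]
  obtain ⟨ζ, hζ⟩ := exists_orderOf_eq (K := K) hq hq2 (N := N) (by omega)
  have hζ1 : ζ ^ (q ^ N - 1) = 1 := hζ ▸ pow_orderOf_eq_one ζ
  have hqN : 1 ≤ q ^ N := Nat.one_le_pow _ _ (by omega)
  have hζq : ζ ^ q ^ N = ζ := by
    rw [← Nat.sub_add_cancel hqN, pow_add, hζ1, one_mul, pow_one]
  rw [eq_comm, ← inv_smul_eq_iff]
  choose A' hA' using fun k : ℕ => M.exists_smul_prod_entry hM (w⁻¹ ^ k) A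
  have key : ∀ b, ∑ k ∈ A' 1, M.p b k = ∑ k ∈ A' 0, M.p b k := by
    intro b
    set φ := M.twistedFrob m with hφ
    -- As `w^N = 1`, the map `φ^N` raises every weight to the power `q^N`, which fixes `ζ`.
    have hper : φ^[N] (M.γ b ζ) = M.γ b ζ := by
      refine M.torus_ext fun k => ?_
      have := M.apply_twistedFrob_iterate (m := m) (χ := M.entry k)
        (by simpa using M.smul_prod_entry_frobTorus hM {k}) N (M.γ b ζ)
      rw [this, ← hw, hwN, one_smul, M.entry_γ, ← zpow_natCast, ← zpow_mul, mul_comm, zpow_mul,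
        zpow_natCast, hζq]
    set t := ∏ k ∈ Finset.range N, φ^[k] (M.γ b ζ) with ht
    -- Applying `φ` shifts the factors of the norm cyclically: compare the two ways of splitting a
    -- factor off the product of `N + 1` iterates.
    have hfix : φ t = t := by
      have h1 : φ t = ∏ k ∈ Finset.range N, φ^[k + 1] (M.γ b ζ) := by
        rw [ht, map_prod]
        exact Finset.prod_congr rfl fun k _ => (Function.iterate_succ_apply' φ k _).symm
      have h2 := Finset.prod_range_succ (fun k => φ^[k] (M.γ b ζ)) N
      rw [Finset.prod_range_succ' (fun k => φ^[k] (M.γ b ζ)) N, ← h1, hper,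
        Function.iterate_zero, id] at h2
      exact mul_right_cancel h2
    have hval : χ t = ζ ^ ∑ k ∈ Finset.range N, (∑ l ∈ A' k, M.p b l) * (q : ℤ) ^ k := by
      rw [ht, map_prod, ← prod_zpow_eq_zpow_sum]
      refine Finset.prod_congr rfl fun k _ => ?_
      rw [M.apply_twistedFrob_iterate (M.smul_prod_entry_frobTorus hM A), hA', M.prod_entry_γ,
        zpow_mul]
      norm_cast
    have h1 := h t hfix
    rw [hval, ← zpow_natCast, ← zpow_mul, mul_comm, ← orderOf_dvd_iff_zpow_eq_one, hζ] at h1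
    push_cast [Nat.cast_sub hqN, Nat.cast_sub (by omega : 1 ≤ q)] at h1
    exact digits_eq_of_dvd_sum (by exact_mod_cast hq2) N (fun k => ∑ l ∈ A' k, M.p b l)
      (fun k => M.abs_sum_p_le b _) h1 1 (by omega) 0 (by omega)
  have h0 := hA' 0
  have h1 := hA' 1
  rw [pow_zero, one_smul] at h0
  rw [pow_one] at h1
  refine M.character_ext fun b s => ?_
  rw [h1, hχ, h0, M.prod_entry_γ, M.prod_entry_γ, key]

theorem prod_entry_pow_injective [IsAlgClosed K] (hq : (q : K) = 0) (hq2 : 2 ≤ q)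
    {A A' : Finset ι} (h : (∏ k ∈ A, M.entry k) ^ (q - 1) = (∏ k ∈ A', M.entry k) ^ (q - 1)) :
    ∏ k ∈ A, M.entry k = ∏ k ∈ A', M.entry k := by
  -- Cancelling `q - 1` from `q³ - 1` leaves the modulus `q² + q + 1`, which exceeds the largest
  -- possible difference `2` of the exponents.
  obtain ⟨ζ, hζ⟩ := exists_orderOf_eq (K := K) hq hq2 (N := 3) (by omega)
  refine M.character_ext fun b s => ?_
  rw [M.prod_entry_γ, M.prod_entry_γ]
  congr 1
  have h1 := DFunLike.congr_fun h (M.γ b ζ)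
  rw [MonoidHom.pow_apply, MonoidHom.pow_apply, M.prod_entry_γ, M.prod_entry_γ, ← zpow_natCast,
    ← zpow_natCast, ← zpow_mul, ← zpow_mul, zpow_eq_zpow_iff_modEq, Int.modEq_iff_dvd,
    hζ, ← sub_mul] at h1
  have ha := M.abs_sum_p_le b A
  have ha' := M.abs_sum_p_le b A'
  generalize ∑ k ∈ A, M.p b k = a at *
  generalize ∑ k ∈ A', M.p b k = a' at *
  have hq3 : 1 ≤ q ^ 3 := Nat.one_le_pow _ _ (by omega)
  push_cast [Nat.cast_sub hq3, Nat.cast_sub (by omega : 1 ≤ q)] at h1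
  have hq2' : (2 : ℤ) ≤ q := by exact_mod_cast hq2
  rw [show (q : ℤ) ^ 3 - 1 = ((q : ℤ) ^ 2 + q + 1) * (q - 1) by ring,
    mul_dvd_mul_iff_right (by omega)] at h1
  rw [abs_le] at ha ha'
  have := Int.eq_zero_of_abs_lt_dvd h1 (by rw [abs_lt]; constructor <;> nlinarith)
  omega

/-- The product of the weights that makes up `ωᵢ`. -/
theorem ω_eq (i : ℕ) : D.ω i =
    ∏ k ∈ (Finset.univ.filter fun j : Fin n => j.val < i).map ⟨M.c, M.c_injective⟩, M.entry k := by
  rw [Finset.prod_map, GroupWithTorus.ω]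
  exact Finset.prod_congr rfl fun j _ => M.ε_eq j

/-- Conjugation by `x` turns `F` on `x T x⁻¹` into `t ↦ m F(t) m⁻¹` on `T`, so `T_w` corresponds to
the fixed points of `twistedFrob m`. The predicate `P` is left free to serve both counts. -/
theorem transport_apply_iff {x : D.Amb} {m : D.normalizer} (hx : x ∈ D.G)
    (hm : (m : D.Amb) = x⁻¹ * D.frob x) (χ : D.torus →* Kˣ) (P : Kˣ → Prop) :
    (∀ t : D.conjugateTorus x, (t : D.Amb) ∈ D.finiteTorus x → P (D.transport x χ t)) ↔
      ∀ t : D.torus, M.twistedFrob m t = t → P (χ t) := by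
  have hfix : ∀ t : D.torus, M.twistedFrob m t = t ↔ D.frob (x * t * x⁻¹) = x * t * x⁻¹ := by
    intro t
    have h1 : (M.twistedFrob m t : D.Amb) = x⁻¹ * D.frob (x * t * x⁻¹) * x := by
      simp [twistedFrob, GroupWithTorus.conjTorus, frobTorus, hm, mul_assoc]
    rw [← Subtype.coe_inj, h1]
    constructor
    · intro h
      have h2 : D.frob (x * t * x⁻¹) = x * (x⁻¹ * D.frob (x * t * x⁻¹) * x) * x⁻¹ := by group
      rw [h2, h]
    · intro h; rw [h]; group
  constructor
  · intro h t ht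
    have hmem : x * t * x⁻¹ ∈ D.conjugateTorus x := ⟨t, t.2, rfl⟩
    have := h ⟨_, hmem⟩ ⟨hmem, D.G.mul_mem (D.G.mul_mem hx (D.torus_le t.2))
      (D.G.inv_mem hx), (hfix t).1 ht⟩
    simpa [GroupWithTorus.transport, mul_assoc] using this
  · rintro h ⟨_, t, ht, rfl⟩ hT
    have := h ⟨t, ht⟩ ((hfix ⟨t, ht⟩).2 hT.2.2)
    simpa [GroupWithTorus.transport, mul_assoc] using this

theorem ncard_weights_eq (M : SplitTorusModel D q ι B) [IsAlgClosed K] (hq : (q : K) = 0) (hq2 : 2 ≤ q) (i : ℕ) {x : D.Amb}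
    {w : D.Weyl} (hx : D.Twists x w) :
    ((Set.ncard {ν ∈ D.weightOrbit x (D.ω i ^ (q - 1)) | ∀ t : D.conjugateTorus x,
        (t : D.Amb) ∈ D.finiteTorus x → ν t = 1} : ℕ) : ℂ) =
      inducedCharacter (D.weylStabilizer i) (fun _ => 1) w ∧
    ((Set.ncard {ν ∈ D.weightOrbit x (D.ω i) | ∀ t : D.conjugateTorus x,
        (t : D.Amb) ∈ D.finiteTorus x → ν t ^ (q - 1) = 1} : ℕ) : ℂ) =
      inducedCharacter (D.weylStabilizer i) (fun _ => 1) w := by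
  have hM := M.entry_injective hq hq2
  have := M.finite_weyl hM
  obtain ⟨hxG, m, hm, rfl⟩ := hx
  have horb : ∀ g : D.Weyl, ∃ A : Finset ι, g • D.ω i = ∏ k ∈ A, M.entry k := fun g => by
    rw [M.ω_eq]; exact M.exists_smul_prod_entry hM g _
  have hfixed : ∀ g : D.Weyl, D.toWeyl m • g • D.ω i = g • D.ω i ↔
      ∀ t, M.twistedFrob m t = t → (g • D.ω i) t ^ (q - 1) = 1 := by
    intro g
    obtain ⟨A, hA⟩ := horb g
    rw [hA]
    constructor
    · intro h t ht
      -- At a fixed point, with `w⁻¹χ = χ`, one iteration reads `χ(t) = χ(t)^q`.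
      have h1 := M.apply_twistedFrob_iterate (m := m) (M.smul_prod_entry_frobTorus hM A) 1 t
      rw [Function.iterate_one, ht, pow_one, pow_one, inv_smul_eq_iff.2 h.symm] at h1
      rw [← mul_left_inj, one_mul, ← pow_succ, Nat.sub_add_cancel (by omega), ← h1]
    · exact M.smul_eq_self_of_pow_eq_one hq hq2 m A
  rw [GroupWithTorus.weylStabilizer, inducedCharacter_stabilizer]
  have hinj : Set.InjOn (fun χ : D.torus →* Kˣ => χ ^ (q - 1))
      {χ ∈ MulAction.orbit D.Weyl (D.ω i) | D.toWeyl m • χ = χ} := by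
    rintro _ ⟨⟨g, rfl⟩, -⟩ _ ⟨⟨h, rfl⟩, -⟩ e
    obtain ⟨A, hA⟩ := horb g
    obtain ⟨A', hA'⟩ := horb h
    simp only [hA, hA'] at e ⊢
    exact M.prod_entry_pow_injective hq hq2 e
  constructor
  · rw [← hinj.ncard_image, ← Set.ncard_image_of_injective _ (D.transport_injective x)]
    congr 2
    ext ν
    constructor
    · rintro ⟨⟨g, rfl⟩, h⟩
      refine ⟨_, ⟨g • D.ω i, ⟨⟨g, rfl⟩, (hfixed g).2 ?_⟩, rfl⟩, by
        rw [D.smul_pow_character]⟩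
      rw [D.smul_pow_character] at h
      exact (M.transport_apply_iff hxG hm _ (· = 1)).1 h
    · rintro ⟨_, ⟨_, ⟨⟨g, rfl⟩, h⟩, rfl⟩, rfl⟩
      refine ⟨⟨g, by rw [D.smul_pow_character]⟩, ?_⟩
      exact (M.transport_apply_iff hxG hm _ (· = 1)).2 ((hfixed g).1 h)
  · rw [← Set.ncard_image_of_injective _ (D.transport_injective x)]
    congr 2
    ext ν
    constructor
    · rintro ⟨⟨g, rfl⟩, h⟩
      refine ⟨_, ⟨⟨g, rfl⟩, (hfixed g).2 ?_⟩, rfl⟩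
      exact (M.transport_apply_iff hxG hm _ (· ^ (q - 1) = 1)).1 h
    · rintro ⟨_, ⟨⟨g, rfl⟩, h⟩, rfl⟩
      refine ⟨⟨g, rfl⟩, ?_⟩
      exact (M.transport_apply_iff hxG hm _ (· ^ (q - 1) = 1)).2 ((hfixed g).1 h)

end SplitTorusModel

/-! ### The field of `q` elements inside `K` -/

theorem mem_range_algebraMap_iff_pow_card_sub_one {F : Type u} [Field F] [Fintype F] {K : Type v}
    [Field K] [Algebra F K] (x : Kˣ) :
    (x : K) ∈ Set.range (algebraMap F K) ↔ x ^ (Fintype.card F - 1) = 1 := by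
  rw [← Units.val_inj, Units.val_pow_eq_pow_val, Units.val_one]
  constructor
  · rintro ⟨a, ha⟩
    rw [← ha, ← map_pow, FiniteField.pow_card_sub_one_eq_one, map_one]
    rintro rfl
    exact x.ne_zero (by rw [← ha, map_zero])
  · intro h
    -- A generator of the cyclic group `Fˣ` maps to a primitive root of unity of order `q - 1`,
    -- whose powers exhaust the solutions in `K`.
    obtain ⟨g, hg⟩ := IsCyclic.exists_ofOrder_eq_natCard (α := Fˣ)
    rw [Nat.card_units, Nat.card_eq_fintype_card] at hg
    have hprim : IsPrimitiveRoot (algebraMap F K g) (Fintype.card F - 1) := by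
      rw [← hg, ← orderOf_units]
      exact (IsPrimitiveRoot.orderOf (g : F)).map_of_injective (algebraMap F K).injective
    have : NeZero (Fintype.card F - 1) :=
      ⟨(Nat.sub_pos_of_lt (Fintype.one_lt_card (α := F))).ne'⟩
    obtain ⟨k, -, hk⟩ := hprim.eq_pow_of_pow_eq_one h
    exact ⟨(g : F) ^ k, by rw [map_pow, hk]⟩

/-! ### Split torus models of matrix groups -/

section MatrixModels

variable {K : Type v} [Field K] {ι : Type} [Fintype ι] [DecidableEq ι]

/-- The diagonal matrix with given invertible entries. -/
def diagonalUnits (ι : Type) [Fintype ι] [DecidableEq ι] (K : Type v) [Field K] :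
    (ι → Kˣ) →* GL ι K :=
  (Units.map (Matrix.diagonalRingHom ι K : (ι → K) →* Matrix ι ι K)).comp
    (MulEquiv.piUnits (M := fun _ : ι => K)).symm.toMonoidHom

theorem coe_diagonalUnits (a : ι → Kˣ) :
    (diagonalUnits ι K a : Matrix ι ι K) = Matrix.diagonal fun k => (a k : K) := rfl

theorem diagonalUnits_mem (a : ι → Kˣ) : diagonalUnits ι K a ∈ diagonalSubgroup ι K :=
  ⟨_, rfl⟩

theorem diagonalUnits_diagonalEntry {g : GL ι K} (hg : g ∈ diagonalSubgroup ι K) :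
    diagonalUnits ι K (fun k => diagonalEntry k ⟨g, hg⟩) = g := by
  ext1
  exact (eq_diagonal_diagonalEntry ⟨g, hg⟩).symm

theorem diagonalEntry_diagonalUnits (a : ι → Kˣ) (k : ι) :
    diagonalEntry k ⟨_, diagonalUnits_mem a⟩ = a k := by
  ext1
  rw [coe_diagonalEntry, coe_diagonalUnits, Matrix.diagonal_apply_eq]

/-- The diagonal model of a matrix group. -/
def matrixDiagonalModel {n : ℕ} (φ : K →+* K) (G : Subgroup (GL ι K)) (c : Fin n → ι) :
    DiagonalModel (matrixGroupWithTorus φ G c) ι where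
  ρ := G.subtype
  injective := G.subtype_injective
  mem_torus_iff g := ⟨fun h => h.2, fun h => ⟨g.2, h⟩⟩

/-- The split torus model of a matrix group whose diagonal torus is parametrized by `B → Kˣ`. -/
def matrixSplitTorusModel {n q : ℕ} {φ : K →+* K} (hφ : ∀ x, φ x = x ^ q) {G : Subgroup (GL ι K)}
    {c : Fin n → ι} (hc : Function.Injective c)
    (hG : ∀ g ∈ G, Matrix.GeneralLinearGroup.map φ g ∈ G)
    {B : Type} [Fintype B] (p : B → ι → ℤ) (d : B → ι)
    (hp : ∀ b (A : Finset ι), |∑ k ∈ A, p b k| ≤ 1)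
    (hp' : ∀ k l, (∀ b, p b k = p b l) → k = l)
    (hγ : ∀ b s, diagonalUnits ι K (fun k => s ^ p b k) ∈ G)
    (hd : ∀ a, diagonalUnits ι K a ∈ G → ∀ k, ∏ b, a (d b) ^ p b k = a k) :
    SplitTorusModel (matrixGroupWithTorus φ G c) q ι B where
  toDiagonalModel := matrixDiagonalModel φ G c
  frob_mem t ht := ⟨hG t ht.1, mem_diagonalSubgroup_of_offDiag fun k j hkj => by
    obtain ⟨a, ha⟩ := mem_diagonalSubgroup ht.2
    change φ (((show GL ι K from t) : Matrix ι ι K) k j) = 0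
    rw [ha, Matrix.diagonal_apply_ne _ hkj, map_zero]⟩
  entry_frob k t := Units.ext (hφ _)
  c := c
  c_injective := hc
  ε_eq _ := rfl
  γ b :=
    { toFun := fun s => ⟨diagonalUnits ι K (fun k => s ^ p b k), hγ b s, diagonalUnits_mem _⟩
      map_one' := Subtype.ext (by
        simp only [one_zpow]
        exact map_one (diagonalUnits ι K))
      map_mul' := fun s t => Subtype.ext (by
        simp only [mul_zpow]
        exact map_mul (diagonalUnits ι K) (fun k => s ^ p b k) (fun k => t ^ p b k)) }
  p := p
  entry_γ b k s := diagonalEntry_diagonalUnits (fun k => s ^ p b k) k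
  abs_sum_p_le := hp
  eq_of_p_eq := hp'
  d := d
  prod_entry_d t k := by
    refine hd (fun k => diagonalEntry k ⟨t.1, t.2.2⟩) ?_ k
    exact (diagonalUnits_diagonalEntry (g := t.1) t.2.2).symm ▸ t.2.1

/-- A subset meets the position of `+1` and that of `-1` at most once each. -/
theorem abs_sum_single_sub_single_le {ι : Type*} [DecidableEq ι] (k l : ι) (A : Finset ι) :
    |∑ j ∈ A, (Pi.single k 1 - Pi.single l 1 : ι → ℤ) j| ≤ 1 := by
  simp only [Pi.sub_apply, Finset.sum_sub_distrib, Finset.sum_pi_single']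
  split_ifs <;> simp

theorem diagonalUnits_mem_isometryGroup {J : Matrix ι ι K} {a : ι → Kˣ} :
    diagonalUnits ι K a ∈ isometryGroup J ↔ ∀ k l, (a k : K) * J k l * a l = J k l := by
  change (diagonalUnits ι K a : Matrix ι ι K)ᵀ * J * (diagonalUnits ι K a : Matrix ι ι K) = J ↔ _
  rw [coe_diagonalUnits, Matrix.diagonal_transpose, ← Matrix.ext_iff]
  simp only [Matrix.mul_diagonal, Matrix.diagonal_mul]

theorem diagonalUnits_mem_specialLinear {a : ι → Kˣ} :
    diagonalUnits ι K a ∈ specialLinear ι K ↔ ∏ k, a k = 1 := by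
  rw [specialLinear, MonoidHom.mem_ker, ← Units.val_inj, Matrix.GeneralLinearGroup.val_det_apply,
    coe_diagonalUnits, Matrix.det_diagonal, ← Units.val_inj]
  simp

theorem map_mem_specialLinear (φ : K →+* K) {g : GL ι K} (hg : g ∈ specialLinear ι K) :
    Matrix.GeneralLinearGroup.map φ g ∈ specialLinear ι K := by
  rw [specialLinear, MonoidHom.mem_ker] at hg ⊢
  rw [Matrix.GeneralLinearGroup.map_det, hg, map_one]

theorem map_mem_isometryGroup (φ : K →+* K) {J : Matrix ι ι K} (hJ : J.map φ = J) {g : GL ι K}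
    (hg : g ∈ isometryGroup J) : Matrix.GeneralLinearGroup.map φ g ∈ isometryGroup J := by
  have hg' : (g : Matrix ι ι K)ᵀ * J * (g : Matrix ι ι K) = J := hg
  change ((g : Matrix ι ι K).map φ)ᵀ * J * (g : Matrix ι ι K).map φ = J
  have := congrArg (fun A => A.map φ) hg'
  simpa only [Matrix.map_mul, hJ, Matrix.transpose_map] using this

end MatrixModels

/-! ### The linear, symplectic and orthogonal groups -/

section ClassicalModels

variable {K : Type v} [Field K] {q : ℕ} {φ : K →+* K} (hφ : ∀ x, φ x = x ^ q) (n : ℕ)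

/-- The model of the general linear group. -/
def generalLinearModel : SplitTorusModel
    (matrixGroupWithTorus (ι := Fin n) φ ⊤ id) q (Fin n) (Fin n) :=
  matrixSplitTorusModel hφ Function.injective_id (G := ⊤)
    (fun _ _ => Subgroup.mem_top _) (fun b => Pi.single b 1) id
    (fun b A => by rw [Finset.sum_pi_single']; split_ifs <;> simp)
    (fun k l h => by simpa [Pi.single_apply, eq_comm] using h k)
    (fun _ _ => Subgroup.mem_top _)
    (fun a _ k => by simp [Pi.single_apply])

/-- The model of the special linear group. -/
def specialLinearModel : SplitTorusModel
    (matrixGroupWithTorus φ (specialLinear (Fin (n + 1)) K) Fin.castSucc) q (Fin (n + 1)) (Fin n) :=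
  matrixSplitTorusModel hφ (Fin.castSucc_injective n) (fun _ => map_mem_specialLinear φ)
    -- Determinant one makes the last entry the inverse of the product of the others, so the first
    -- `n` entries are free coordinates and each is compensated in the last position.
    (fun b => Pi.single b.castSucc 1 - Pi.single (Fin.last n) 1) Fin.castSucc
    (fun b A => abs_sum_single_sub_single_le _ _ A)
    (fun k l h => by
      cases k using Fin.lastCases <;> cases l using Fin.lastCases
      · rfl
      · rename_i l
        have := h l
        simp [(Fin.castSucc_ne_last _).symm] at this
      · rename_i k
        have := h k
        simp [(Fin.castSucc_ne_last _).symm] at this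
      · rename_i k l
        simpa [Pi.single_apply, eq_comm] using h k)
    (fun b s => by
      rw [diagonalUnits_mem_specialLinear, prod_zpow_eq_zpow_sum]
      simp)
    (fun a ha k => by
      rw [diagonalUnits_mem_specialLinear, Fin.prod_univ_castSucc] at ha
      cases k using Fin.lastCases with
      | last =>
        simp [(Fin.castSucc_ne_last _).symm, eq_inv_of_mul_eq_one_left ha]
      | cast k => simp [Pi.single_apply, Fin.castSucc_ne_last, apply_ite])

theorem hyperbolic_eq_of_eq (k l : Fin n ⊕ Fin n)
    (h : ∀ b, (Pi.single (Sum.inl b) 1 - Pi.single (Sum.inr b) 1 : Fin n ⊕ Fin n → ℤ) k =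
      (Pi.single (Sum.inl b) 1 - Pi.single (Sum.inr b) 1 : Fin n ⊕ Fin n → ℤ) l) : k = l := by
  rcases k with k | k <;> rcases l with l | l <;> have := h k <;> have := h l <;>
    simp [Pi.single_apply] at * <;> grind

theorem prod_hyperbolic {a : Fin n ⊕ Fin n → Kˣ} (ha : ∀ j, a (Sum.inl j) * a (Sum.inr j) = 1)
    (k : Fin n ⊕ Fin n) : ∏ b, a (Sum.inl b) ^
      (Pi.single (Sum.inl b) 1 - Pi.single (Sum.inr b) 1 : Fin n ⊕ Fin n → ℤ) k = a k := by
  rcases k with k | k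
  · simp [Pi.single_apply, apply_ite]
  · simp [Pi.single_apply, apply_ite, eq_inv_of_mul_eq_one_right (ha k)]

theorem coe_mul_coe_of_hyperbolic {n : ℕ} {a : Fin n ⊕ Fin n → Kˣ}
    (ha : ∀ j, a (Sum.inl j) * a (Sum.inr j) = 1) (j : Fin n) :
    (a (Sum.inl j) : K) * a (Sum.inr j) = 1 ∧ (a (Sum.inr j) : K) * a (Sum.inl j) = 1 := by
  have := congrArg Units.val (ha j)
  rw [Units.val_mul, Units.val_one] at this
  exact ⟨this, by rw [mul_comm, this]⟩

/-- The model of a group of matrices on `n` hyperbolic pairs. -/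
def hyperbolicModel {G : Subgroup (GL (Fin n ⊕ Fin n) K)}
    (hG : ∀ g ∈ G, Matrix.GeneralLinearGroup.map φ g ∈ G)
    (hG' : ∀ a, diagonalUnits _ K a ∈ G ↔ ∀ j, a (Sum.inl j) * a (Sum.inr j) = 1) :
    SplitTorusModel (matrixGroupWithTorus φ G Sum.inl) q (Fin n ⊕ Fin n) (Fin n) :=
  matrixSplitTorusModel hφ Sum.inl_injective hG
    (fun b => Pi.single (Sum.inl b) 1 - Pi.single (Sum.inr b) 1) Sum.inl
    (fun b A => abs_sum_single_sub_single_le _ _ A)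
    (hyperbolic_eq_of_eq n)
    (fun b s => by
      rw [hG']
      intro j
      by_cases h : j = b <;> simp [h])
    (fun a ha k => prod_hyperbolic n ((hG' a).1 ha) k)

/-- The model of the symplectic group. -/
def symplecticModel : SplitTorusModel
    (matrixGroupWithTorus φ (isometryGroup (Matrix.J (Fin n) K)) Sum.inl) q
    (Fin n ⊕ Fin n) (Fin n) :=
  hyperbolicModel hφ n
    (fun _ => map_mem_isometryGroup φ (by
      simp [Matrix.J, Matrix.fromBlocks_map, Matrix.map_one, Matrix.map_neg]))
    (fun a => by
      rw [diagonalUnits_mem_isometryGroup]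
      constructor
      · intro h j
        -- This position of the Gram matrix carries `1`; the transposed one carries `-1`.
        have := h (Sum.inr j) (Sum.inl j)
        rw [← Units.val_inj]
        simpa [Matrix.J, mul_comm] using this
      · intro h k l
        rcases k with k | k <;> rcases l with l | l <;> by_cases hkl : k = l <;>
          simp [Matrix.J, hkl, coe_mul_coe_of_hyperbolic h])

/-- The model of the split special orthogonal group in even dimension. -/
def plusOrthogonalModel : SplitTorusModel
    (matrixGroupWithTorus φ (isometryGroup (LieAlgebra.Orthogonal.JD (Fin n) K) ⊓
      specialLinear (Fin n ⊕ Fin n) K) Sum.inl) q (Fin n ⊕ Fin n) (Fin n) :=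
  hyperbolicModel hφ n
    (fun _ hg => ⟨map_mem_isometryGroup φ (by
      simp [LieAlgebra.Orthogonal.JD, Matrix.fromBlocks_map, Matrix.map_one]) hg.1,
        map_mem_specialLinear φ hg.2⟩)
    (fun a => by
      rw [Subgroup.mem_inf, diagonalUnits_mem_isometryGroup, diagonalUnits_mem_specialLinear]
      constructor
      · rintro ⟨h, -⟩ j
        have := h (Sum.inr j) (Sum.inl j)
        rw [← Units.val_inj]
        simpa [LieAlgebra.Orthogonal.JD, mul_comm] using this
      · intro h
        refine ⟨?_, ?_⟩
        · intro k l
          rcases k with k | k <;> rcases l with l | l <;> by_cases hkl : k = l <;>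
            simp [LieAlgebra.Orthogonal.JD, hkl, coe_mul_coe_of_hyperbolic h]
        · rw [Fintype.prod_sum_type, ← Finset.prod_mul_distrib]
          exact Finset.prod_eq_one fun j _ => h j)

/-- The model of the special orthogonal group in odd dimension. -/
def oddOrthogonalModel : SplitTorusModel
    (matrixGroupWithTorus φ (isometryGroup (LieAlgebra.Orthogonal.JB (Fin n) K) ⊓
      specialLinear (Unit ⊕ Fin n ⊕ Fin n) K) (fun i => Sum.inr (Sum.inl i))) q
    (Unit ⊕ Fin n ⊕ Fin n) (Fin n) :=
  have hG : ∀ a : Unit ⊕ Fin n ⊕ Fin n → Kˣ, diagonalUnits _ K a ∈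
      isometryGroup (LieAlgebra.Orthogonal.JB (Fin n) K) ⊓ specialLinear _ K ↔
      a (Sum.inl ()) = 1 ∧ ∀ j, a (Sum.inr (Sum.inl j)) * a (Sum.inr (Sum.inr j)) = 1 := by
    intro a
    rw [Subgroup.mem_inf, diagonalUnits_mem_isometryGroup, diagonalUnits_mem_specialLinear,
      Fintype.prod_sum_type, Fintype.prod_sum_type, ← Finset.prod_mul_distrib, Fintype.prod_unique]
    constructor
    · rintro ⟨h, hdet⟩
      have hj : ∀ j, a (Sum.inr (Sum.inl j)) * a (Sum.inr (Sum.inr j)) = 1 := by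
        intro j
        have := h (Sum.inr (Sum.inr j)) (Sum.inr (Sum.inl j))
        rw [← Units.val_inj]
        simpa [LieAlgebra.Orthogonal.JB, LieAlgebra.Orthogonal.JD, mul_comm] using this
      -- The hyperbolic pairs contribute `1` to the determinant, so the determinant condition itself
      -- makes the remaining entry `1`.
      rw [Finset.prod_eq_one fun j _ => hj j, mul_one] at hdet
      exact ⟨hdet, hj⟩
    · rintro ⟨h0, h⟩
      refine ⟨?_, by rw [Finset.prod_eq_one fun j _ => h j, mul_one]; exact h0⟩
      have h' := coe_mul_coe_of_hyperbolic (a := fun k => a (Sum.inr k)) h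
      rintro (k | k | k) (l | l | l)
      · simp [h0]
      all_goals first
        | simp [LieAlgebra.Orthogonal.JB]; done
        | by_cases hkl : k = l <;>
            simp [LieAlgebra.Orthogonal.JB, LieAlgebra.Orthogonal.JD, hkl, h']
  matrixSplitTorusModel hφ (Sum.inr_injective.comp Sum.inl_injective)
    (G := isometryGroup (LieAlgebra.Orthogonal.JB (Fin n) K) ⊓
      specialLinear (Unit ⊕ Fin n ⊕ Fin n) K)
    (fun _ hg => ⟨map_mem_isometryGroup φ (by
      simp [LieAlgebra.Orthogonal.JB, LieAlgebra.Orthogonal.JD, Matrix.fromBlocks_map,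
        Matrix.map_one, two_smul, Matrix.map_add]) hg.1, map_mem_specialLinear φ hg.2⟩)
    (fun b => Pi.single (Sum.inr (Sum.inl b)) 1 - Pi.single (Sum.inr (Sum.inr b)) 1)
    (fun b => Sum.inr (Sum.inl b))
    (fun b A => abs_sum_single_sub_single_le _ _ A)
    (fun k l h => by
      rcases k with k | k | k <;> rcases l with l | l | l
      · rfl
      all_goals
        first | have := h k | skip
        first | have := h l | skip
        simp [Pi.single_apply] at * <;> grind)
    (fun b s => by
      rw [hG]
      refine ⟨by simp, fun j => ?_⟩
      by_cases h : j = b <;> simp [h])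
    (fun a ha k => by
      rw [hG] at ha
      rcases k with k | k | k
      · simp [ha.1]
      · simp [Pi.single_apply, apply_ite]
      · simp [Pi.single_apply, apply_ite, eq_inv_of_mul_eq_one_right (ha.2 k)])

end ClassicalModels

/-! ### Clifford algebras -/

section Clifford

open CliffordAlgebra

/-- Conjugation by elements of the Lipschitz group keeps vectors as vectors, also if two is not
invertible. -/
theorem exists_ι_eq_conj_of_mem_lipschitzGroup {R M : Type*} [CommRing R] [AddCommGroup M]
    [Module R M] {Q : QuadraticForm R M} {x : (CliffordAlgebra Q)ˣ} (hx : x ∈ lipschitzGroup Q)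
    (hQ : ∀ m, IsUnit (ι Q m) → IsUnit (Q m)) (m : M) :
    ∃ m', ι Q m' = x * ι Q m * (x⁻¹ : (CliffordAlgebra Q)ˣ) := by
  unfold lipschitzGroup at hx
  induction hx using Subgroup.closure_induction'' generalizing m with
  | mem x hx =>
    obtain ⟨a, ha⟩ := hx
    let := x.invertible
    let : Invertible (ι Q a) := by rwa [ha]
    let : Invertible (Q a) := (hQ a (isUnit_of_invertible _)).invertible
    simp_rw [← invOf_units x, ← ha, ι_mul_ι_mul_invOf_ι]
    exact ⟨_, rfl⟩
  | inv_mem x hx =>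
    obtain ⟨a, ha⟩ := hx
    let := x.invertible
    let : Invertible (ι Q a) := by rwa [ha]
    let : Invertible (Q a) := (hQ a (isUnit_of_invertible _)).invertible
    simp_rw [← invOf_units x, inv_inv, ← ha, invOf_ι_mul_ι_mul_ι]
    exact ⟨_, rfl⟩
  | one => exact ⟨m, by simp⟩
  | mul y z _ _ hy hz =>
    obtain ⟨z', hz'⟩ := hz m
    obtain ⟨y', hy'⟩ := hy z'
    exact ⟨y', by rw [hy', hz']; simp [mul_assoc]⟩

/-- Contraction with the polar form of `v` is the graded commutator with `v`: both sides satisfy the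
same recursion under left multiplication by a vector, by `vm + mv = polar(v, m)`. For even elements,
commuting with vectors thus becomes vanishing of contractions, in every characteristic. -/
theorem contractLeft_polar {R M : Type*} [CommRing R] [AddCommGroup M] [Module R M]
    (Q : QuadraticForm R M) (v : M) (x : CliffordAlgebra Q) :
    contractLeft (Q.polarBilin v) x = ι Q v * x - involute x * ι Q v := by
  induction x using CliffordAlgebra.left_induction with
  | algebraMap r => rw [contractLeft_algebraMap, AlgHom.commutes, Algebra.commutes, sub_self]
  | add x y hx hy => rw [map_add, map_add, hx, hy, mul_add, add_mul]; abel
  | ι_mul x m hx =>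
    have h := ι_mul_ι_add_swap (Q := Q) v m
    rw [contractLeft_ι_mul, hx, map_mul, involute_ι, Algebra.smul_def,
      QuadraticMap.polarBilin_apply_apply, ← h]
    noncomm_ring

theorem contractLeft_eq_zero_of_commute {R M : Type*} [CommRing R] [AddCommGroup M] [Module R M]
    {Q : QuadraticForm R M} {x : CliffordAlgebra Q} (hx : involute x = x) (v : M)
    (h : ι Q v * x = x * ι Q v) : contractLeft (Q.polarBilin v) x = 0 := by
  rw [contractLeft_polar, hx, h, sub_self]

variable {K : Type v} [Field K] {κ : Type} [Fintype κ] [DecidableEq κ]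

/-- In the exterior algebra, `x ↦ x - eⱼ ∧ (eⱼ* ⌋ x)` removes the monomials that contain `eⱼ`. -/
def removeCoordinate (K : Type v) [Field K] {κ : Type} [Fintype κ] [DecidableEq κ] (j : κ) :
    CliffordAlgebra (0 : QuadraticForm K (κ → K)) →ₗ[K]
      CliffordAlgebra (0 : QuadraticForm K (κ → K)) :=
  LinearMap.id - LinearMap.mulLeft K (ι _ (Pi.single j 1)) ∘ₗ
    contractLeft (LinearMap.proj (R := K) (φ := fun _ : κ => K) j)

theorem removeCoordinate_apply (j : κ) (x : CliffordAlgebra (0 : QuadraticForm K (κ → K))) :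
    removeCoordinate K j x = x - ι _ (Pi.single j 1) *
      contractLeft (LinearMap.proj (R := K) (φ := fun _ : κ => K) j) x := rfl

theorem removeCoordinate_mul_self (j : κ) (y : CliffordAlgebra (0 : QuadraticForm K (κ → K))) :
    removeCoordinate K j (ι _ (Pi.single j 1) * y) = 0 := by
  have h : ι (0 : QuadraticForm K (κ → K)) (Pi.single j 1) * ι _ (Pi.single j 1) = 0 := by
    rw [ι_sq_scalar, zero_apply, map_zero]
  rw [removeCoordinate_apply, contractLeft_ι_mul, mul_sub, ← mul_assoc _ _ (CliffordAlgebra.contractLeft _ _), h]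
  simp

/-- Passing `eₖ` costs one sign in the contraction and one in swapping it with `eⱼ`; the signs
cancel. -/
theorem removeCoordinate_mul_of_ne {j k : κ} (hjk : k ≠ j)
    (y : CliffordAlgebra (0 : QuadraticForm K (κ → K))) :
    removeCoordinate K j (ι _ (Pi.single k 1) * y) =
      ι _ (Pi.single k 1) * removeCoordinate K j y := by
  have h : ι (0 : QuadraticForm K (κ → K)) (Pi.single j 1) * ι _ (Pi.single k 1) =
      -(ι (0 : QuadraticForm K (κ → K)) (Pi.single k 1) * ι _ (Pi.single j 1)) := by
    rw [eq_neg_iff_add_eq_zero, ι_mul_ι_add_swap]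
    simp [QuadraticMap.polar]
  rw [removeCoordinate_apply, removeCoordinate_apply, contractLeft_ι_mul, mul_sub, mul_sub,
    ← mul_assoc _ _ (CliffordAlgebra.contractLeft _ _), h]
  simp [hjk.symm, mul_assoc]

/-- The composition of the maps `removeCoordinate` along a list. -/
def removeCoordinates (K : Type v) [Field K] {κ : Type} [Fintype κ] [DecidableEq κ] :
    List κ → CliffordAlgebra (0 : QuadraticForm K (κ → K)) →ₗ[K]
      CliffordAlgebra (0 : QuadraticForm K (κ → K))
  | [] => LinearMap.id
  | j :: l => removeCoordinates K l ∘ₗ removeCoordinate K j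

theorem removeCoordinates_mul_of_mem {l : List κ} {k : κ} (hk : k ∈ l)
    (y : CliffordAlgebra (0 : QuadraticForm K (κ → K))) :
    removeCoordinates K l (ι _ (Pi.single k 1) * y) = 0 := by
  induction l generalizing y with
  | nil => simp at hk
  | cons j l ih =>
    rw [removeCoordinates, LinearMap.comp_apply]
    rcases eq_or_ne k j with rfl | hkj
    · rw [removeCoordinate_mul_self, map_zero]
    · rw [removeCoordinate_mul_of_ne hkj, ih ((List.mem_cons.1 hk).resolve_left hkj)]

theorem removeCoordinates_mem_range {l : List κ} (hl : ∀ k, k ∈ l)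
    (x : CliffordAlgebra (0 : QuadraticForm K (κ → K))) :
    ∃ c, removeCoordinates K l x = algebraMap K _ c := by
  induction x using CliffordAlgebra.left_induction with
  | algebraMap r =>
    refine ⟨r, ?_⟩
    -- The tail of the list need not contain every index, so the induction must not carry `hl`.
    clear hl
    induction l with
    | nil => rfl
    | cons j l ih =>
      rw [removeCoordinates, LinearMap.comp_apply, removeCoordinate_apply, contractLeft_algebraMap,
        mul_zero, sub_zero, ih]
  | add x y hx hy =>
    obtain ⟨c, hc⟩ := hx
    obtain ⟨d, hd⟩ := hy
    exact ⟨c + d, by rw [map_add, hc, hd, map_add]⟩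
  | ι_mul x m _ =>
    -- A product with a basis vector on the left is killed once the list reaches the index of that
    -- vector.
    refine ⟨0, ?_⟩
    rw [pi_eq_sum_univ' m, map_sum, Finset.sum_mul, map_sum, map_zero]
    refine Finset.sum_eq_zero fun k _ => ?_
    rw [map_smul, smul_mul_assoc, map_smul, removeCoordinates_mul_of_mem (hl k), smul_zero]

/-- If all coordinate contractions of `x` vanish, every `removeCoordinate` fixes `x`; yet removing
all coordinates leaves only a scalar. -/
theorem mem_range_of_contractLeft_eq_zero {x : CliffordAlgebra (0 : QuadraticForm K (κ → K))}
    (h : ∀ j, contractLeft (LinearMap.proj (R := K) (φ := fun _ : κ => K) j) x = 0) :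
    ∃ c, x = algebraMap K _ c := by
  obtain ⟨c, hc⟩ := removeCoordinates_mem_range (l := Finset.univ.toList) (by simp) x
  refine ⟨c, hc ▸ ?_⟩
  generalize (Finset.univ : Finset κ).toList = l
  induction l with
  | nil => rfl
  | cons j l ih =>
    rw [removeCoordinates, LinearMap.comp_apply, removeCoordinate_apply, h, mul_zero, sub_zero,
      ← ih]

end Clifford

/-! ### The Clifford algebra of the split form -/

section SplitForm

open CliffordAlgebra

variable {K : Type v} [Field K] (n : ℕ)

theorem polar_splitForm (x y : Fin n ⊕ Fin n → K) :
    QuadraticMap.polar (splitForm K n) x y =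
      ∑ i, (x (Sum.inl i) * y (Sum.inr i) + x (Sum.inr i) * y (Sum.inl i)) := by
  simp only [QuadraticMap.polar, splitForm_apply, ← Finset.sum_sub_distrib, Pi.add_apply]
  exact Finset.sum_congr rfl fun i _ => by ring

/-- The bilinear form `-∑ xᵢ yᵢ'`, which deforms the split form to zero. -/
theorem exists_bilinForm_splitForm : ∃ B : LinearMap.BilinForm K (Fin n ⊕ Fin n → K),
    B.toQuadraticMap = 0 - splitForm K n := by
  refine ⟨-∑ i : Fin n, LinearMap.BilinForm.linMulLin
      (LinearMap.proj (R := K) (φ := fun _ => K) (Sum.inl i : Fin n ⊕ Fin n))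
      (LinearMap.proj (R := K) (φ := fun _ => K) (Sum.inr i : Fin n ⊕ Fin n)), ?_⟩
  ext x
  simp [splitForm_apply, LinearMap.BilinForm.linMulLin]

theorem polarBilin_splitForm_single (j : Fin n ⊕ Fin n) :
    (splitForm K n).polarBilin (Pi.single j 1) =
      LinearMap.proj (R := K) (φ := fun _ => K) j.swap := by
  refine LinearMap.ext fun y => ?_
  rw [QuadraticMap.polarBilin_apply_apply, polar_splitForm]
  rcases j with j | j <;> simp [Pi.single_apply]

/-- An even element of the Clifford algebra that commutes with the vectors is a scalar. -/
theorem eq_algebraMap_of_commute {x : SplitClifford K n} (hx : involute x = x)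
    (h : ∀ j, basisVector K n j * x = x * basisVector K n j) :
    ∃ c, x = algebraMap K _ c := by
  obtain ⟨B, hB⟩ := exists_bilinForm_splitForm (K := K) n
  have hz : ∀ j, contractLeft (LinearMap.proj (R := K) (φ := fun _ : Fin n ⊕ Fin n => K) j)
      (changeForm hB x) = 0 := by
    intro j
    -- The polar form of a basis vector is the coordinate of its hyperbolic partner, so all
    -- coordinate contractions of `x` vanish; `changeForm` carries this to the exterior algebra.
    have h1 := contractLeft_eq_zero_of_commute hx (Pi.single j.swap 1) (h j.swap)
    rw [polarBilin_splitForm_single, Sum.swap_swap] at h1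
    rw [← changeForm_contractLeft, h1, map_zero]
  obtain ⟨c, hc⟩ := mem_range_of_contractLeft_eq_zero hz
  refine ⟨c, (changeFormEquiv hB).injective ?_⟩
  exact hc.trans (changeForm_algebraMap hB c).symm

theorem basisVector_mul_self (j : Fin n ⊕ Fin n) :
    basisVector K n j * basisVector K n j = 0 := by
  rw [basisVector, ι_sq_scalar, splitForm_apply]
  rcases j with j | j <;> simp

theorem basisVector_mul_add_swap (j k : Fin n ⊕ Fin n) :
    basisVector K n j * basisVector K n k + basisVector K n k * basisVector K n j =
      if k = j.swap then 1 else 0 := by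
  rw [basisVector, basisVector, ι_mul_ι_add_swap, ← QuadraticMap.polarBilin_apply_apply,
    polarBilin_splitForm_single]
  by_cases h : k = j.swap
  · simp [h]
  · simp [h, eq_comm]

instance : Nontrivial (SplitClifford K n) :=
  have h := (exists_bilinForm_splitForm (K := K) n).choose_spec
  have : Nontrivial (CliffordAlgebra (0 : QuadraticForm K (Fin n ⊕ Fin n → K))) :=
    inferInstanceAs (Nontrivial (ExteriorAlgebra K (Fin n ⊕ Fin n → K)))
  (changeFormEquiv h).toEquiv.nontrivial

theorem isUnit_splitForm_of_isUnit_ι (v : Fin n ⊕ Fin n → K) (h : IsUnit (ι (splitForm K n) v)) :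
    IsUnit (splitForm K n v) := by
  rw [isUnit_iff_ne_zero]
  intro h0
  have h1 := h.mul h
  rw [ι_sq_scalar, h0, map_zero] at h1
  exact not_isUnit_zero h1

end SplitForm

/-! ### The vector representation of the spin group -/

section Spin

open CliffordAlgebra

variable {K : Type v} [Field K] {n : ℕ}

theorem mem_splitSpin_iff {x : (SplitClifford K n)ˣ} : x ∈ splitSpin K n ↔
    x ∈ lipschitzGroup (splitForm K n) ∧ (x : SplitClifford K n) ∈ unitary (SplitClifford K n) ∧
      (x : SplitClifford K n) ∈ evenOdd (splitForm K n) 0 := by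
  change (x : SplitClifford K n) ∈ spinGroup (splitForm K n) ↔ _
  rw [spinGroup.mem_iff, pinGroup.units_mem_iff, and_assoc, ← even_toSubmodule]
  rfl

/-- A linear retraction of the Clifford algebra onto the space of vectors. -/
def vectorPart (K : Type v) [Field K] (n : ℕ) : SplitClifford K n →ₗ[K] (Fin n ⊕ Fin n → K) :=
  ((ι (splitForm K n)).exists_leftInverse_of_injective
    (LinearMap.ker_eq_bot.2 (ι_splitForm_injective K n))).choose

theorem vectorPart_ι (v : Fin n ⊕ Fin n → K) : vectorPart K n (ι (splitForm K n) v) = v :=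
  LinearMap.congr_fun ((ι (splitForm K n)).exists_leftInverse_of_injective
    (LinearMap.ker_eq_bot.2 (ι_splitForm_injective K n))).choose_spec v

/-- The action `v ↦ x v x⁻¹` on vectors. -/
def vectorAction (x : (SplitClifford K n)ˣ) :
    (Fin n ⊕ Fin n → K) →ₗ[K] (Fin n ⊕ Fin n → K) :=
  vectorPart K n ∘ₗ LinearMap.mulLeft K (x : SplitClifford K n) ∘ₗ
    LinearMap.mulRight K ((x⁻¹ : (SplitClifford K n)ˣ) : SplitClifford K n) ∘ₗ ι (splitForm K n)

theorem ι_vectorAction {x : (SplitClifford K n)ˣ} (hx : x ∈ splitSpin K n)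
    (v : Fin n ⊕ Fin n → K) : ι (splitForm K n) (vectorAction x v) =
      x * ι (splitForm K n) v * (x⁻¹ : (SplitClifford K n)ˣ) := by
  obtain ⟨w, hw⟩ := exists_ι_eq_conj_of_mem_lipschitzGroup (mem_splitSpin_iff.1 hx).1
    (isUnit_splitForm_of_isUnit_ι n) v
  have : vectorAction x v =
      vectorPart K n (x * (ι (splitForm K n) v * (x⁻¹ : (SplitClifford K n)ˣ))) := rfl
  rw [this, ← mul_assoc, ← hw, vectorPart_ι]

/-- The vector representation of the spin group by linear maps. -/
def vectorRepLinear (K : Type v) [Field K] (n : ℕ) :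
    splitSpin K n →* Module.End K (Fin n ⊕ Fin n → K) where
  toFun x := vectorAction (x : (SplitClifford K n)ˣ)
  map_one' := by
    refine LinearMap.ext fun v => ι_splitForm_injective K n ?_
    rw [ι_vectorAction (1 : splitSpin K n).2]
    simp
  map_mul' x y := by
    refine LinearMap.ext fun v => ι_splitForm_injective K n ?_
    rw [ι_vectorAction (x * y).2, Module.End.mul_apply, ι_vectorAction x.2, ι_vectorAction y.2]
    simp [mul_assoc]

/-- The vector representation of the spin group by matrices. -/
def vectorRep (K : Type v) [Field K] (n : ℕ) : splitSpin K n →* GL (Fin n ⊕ Fin n) K :=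
  MonoidHom.toHomUnits ((LinearMap.toMatrixAlgEquiv' (R := K) (n := Fin n ⊕ Fin n) :
    Module.End K (Fin n ⊕ Fin n → K) →* Matrix (Fin n ⊕ Fin n) (Fin n ⊕ Fin n) K).comp
      (vectorRepLinear K n))

theorem vectorRep_apply (x : splitSpin K n) (k j : Fin n ⊕ Fin n) :
    (vectorRep K n x : Matrix _ _ K) k j =
      vectorAction (x : (SplitClifford K n)ˣ) (Pi.single j 1) k := by
  change LinearMap.toMatrixAlgEquiv' (vectorAction (x : (SplitClifford K n)ˣ)) k j = _
  rw [LinearMap.toMatrixAlgEquiv'_apply]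

theorem vectorRep_eq_diagonal_iff (x : splitSpin K n) (a : Fin n ⊕ Fin n → K) :
    (vectorRep K n x : Matrix _ _ K) = Matrix.diagonal a ↔
      ∀ j, ((x : (SplitClifford K n)ˣ) : SplitClifford K n) * basisVector K n j *
        (((x : (SplitClifford K n)ˣ)⁻¹ : (SplitClifford K n)ˣ)) = a j • basisVector K n j := by
  have h : ∀ j, ((x : (SplitClifford K n)ˣ) : SplitClifford K n) * basisVector K n j *
      (((x : (SplitClifford K n)ˣ)⁻¹ : (SplitClifford K n)ˣ)) = a j • basisVector K n j ↔
        vectorAction (x : (SplitClifford K n)ˣ) (Pi.single j 1) = Pi.single j (a j) := by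
    intro j
    rw [basisVector, ← ι_vectorAction x.2, ← map_smul, (ι_splitForm_injective K n).eq_iff,
      ← Pi.single_smul, smul_eq_mul, mul_one]
  simp only [h, ← Matrix.ext_iff, vectorRep_apply, funext_iff]
  rw [forall_comm]
  simp only [Matrix.diagonal_apply, Pi.single_apply]
  refine forall_congr' fun j => forall_congr' fun k => ?_
  by_cases hkj : k = j <;> simp [hkj]

theorem ActsDiagonally.vectorRep_eq {x : splitSpin K n} {a : Fin n → Kˣ}
    (h : ActsDiagonally (x : (SplitClifford K n)ˣ) a) : (vectorRep K n x : Matrix _ _ K) =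
      Matrix.diagonal (Sum.elim (fun i => (a i : K)) fun i => ((a i)⁻¹ : K)) := by
  rw [vectorRep_eq_diagonal_iff]
  rintro (i | i)
  · exact (h i).1
  · exact (h i).2

theorem actsDiagonally_of_vectorRep_mem {x : splitSpin K n}
    (h : vectorRep K n x ∈ diagonalSubgroup _ K) :
    ∃ a, ActsDiagonally (x : (SplitClifford K n)ˣ) a := by
  obtain ⟨d, hd⟩ := mem_diagonalSubgroup h
  rw [vectorRep_eq_diagonal_iff] at hd
  -- Conjugation by `x` preserves the relation `ef + fe = 1`, while it multiplies the left side by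
  -- the product of the two eigenvalues.
  have hmul : ∀ i, d (Sum.inl i) * d (Sum.inr i) = 1 := by
    intro i
    have h1 := basisVector_mul_add_swap (K := K) n (Sum.inl i) (Sum.inr i)
    have h2 : (((x : (SplitClifford K n)ˣ) : SplitClifford K n) * basisVector K n (Sum.inl i) *
        (((x : (SplitClifford K n)ˣ)⁻¹ : (SplitClifford K n)ˣ))) *
        (((x : (SplitClifford K n)ˣ) : SplitClifford K n) * basisVector K n (Sum.inr i) *
        (((x : (SplitClifford K n)ˣ)⁻¹ : (SplitClifford K n)ˣ))) +
        (((x : (SplitClifford K n)ˣ) : SplitClifford K n) * basisVector K n (Sum.inr i) *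
        (((x : (SplitClifford K n)ˣ)⁻¹ : (SplitClifford K n)ˣ))) *
        (((x : (SplitClifford K n)ˣ) : SplitClifford K n) * basisVector K n (Sum.inl i) *
        (((x : (SplitClifford K n)ˣ)⁻¹ : (SplitClifford K n)ˣ))) = 1 := by
      calc _ = ((x : (SplitClifford K n)ˣ) : SplitClifford K n) *
          (basisVector K n (Sum.inl i) * basisVector K n (Sum.inr i) +
            basisVector K n (Sum.inr i) * basisVector K n (Sum.inl i)) *
          (((x : (SplitClifford K n)ˣ)⁻¹ : (SplitClifford K n)ˣ)) := by
            simp [mul_add, add_mul, mul_assoc]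
        _ = 1 := by rw [h1]; simp
    rw [hd, hd, smul_mul_smul_comm, smul_mul_smul_comm, mul_comm (d (Sum.inr i)), ← smul_add, h1]
      at h2
    simp only [Sum.swap_inl, if_true, ← Algebra.algebraMap_eq_smul_one] at h2
    exact (algebraMap K (SplitClifford K n)).injective (h2.trans (map_one _).symm)
  refine ⟨fun i => Units.mkOfMulEqOne _ _ (hmul i), fun i => ⟨hd _, ?_⟩⟩
  rw [Units.val_mkOfMulEqOne, inv_eq_of_mul_eq_one_right (hmul i)]
  exact hd _

/-- An element of the kernel is even and commutes with all vectors, hence is a scalar `c`; unitarity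
gives `c² = 1`. In characteristic two this leaves only `c = 1`. -/
theorem vectorRep_injective (h2 : (2 : K) = 0) : Function.Injective (vectorRep K n) := by
  rw [injective_iff_map_eq_one]
  intro x hx
  have h1 := (vectorRep_eq_diagonal_iff x 1).1 (by rw [hx]; simp)
  obtain ⟨-, hu, -⟩ := mem_splitSpin_iff.1 x.2
  obtain ⟨c, hc⟩ := eq_algebraMap_of_commute n
    (spinGroup.involute_eq (show ((x : (SplitClifford K n)ˣ) : SplitClifford K n) ∈ _ from x.2))
    (fun j => by
      have := h1 j
      rw [Pi.one_apply, one_smul, Units.mul_inv_eq_iff_eq_mul] at this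
      exact this.symm)
  rw [Unitary.mem_iff, hc, star_algebraMap, ← map_mul] at hu
  have hcc : c * c = 1 := (algebraMap K (SplitClifford K n)).injective (hu.1.trans (map_one _).symm)
  have hc1 : c = 1 := by
    rw [← sub_eq_zero, ← pow_eq_zero_iff (two_ne_zero)]
    linear_combination hcc - (c - 1) * h2
  ext
  rw [hc, hc1, map_one]
  rfl

/-! ### The Frobenius map of the spin group -/

theorem cliffordFrob_mem_lipschitzGroup (φ : K →+* K) {x : (SplitClifford K n)ˣ}
    (hx : x ∈ lipschitzGroup (splitForm K n)) :
    Units.map (cliffordFrob n φ : SplitClifford K n →* SplitClifford K n) x ∈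
      lipschitzGroup (splitForm K n) := by
  rw [← Subgroup.mem_comap]
  refine (Subgroup.closure_le _).2 ?_ hx
  rintro y ⟨v, hv⟩
  refine Subgroup.subset_closure ⟨fun j => φ (v j), ?_⟩
  rw [Units.coe_map, ← hv]
  exact (cliffordFrob_ι n φ v).symm

theorem cliffordFrob_star (φ : K →+* K) (x : SplitClifford K n) :
    cliffordFrob n φ (star x) = star (cliffordFrob n φ x) := by
  induction x using CliffordAlgebra.induction with
  | algebraMap r => rw [star_algebraMap, cliffordFrob_algebraMap, star_algebraMap]
  | ι v => rw [star_ι, map_neg, cliffordFrob_ι, star_ι]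
  | mul x y hx hy => rw [star_mul, map_mul, hx, hy, map_mul, star_mul]
  | add x y hx hy => rw [star_add, map_add, hx, hy, map_add, star_add]

theorem cliffordFrob_mem_evenOdd_zero (φ : K →+* K) {x : SplitClifford K n}
    (hx : x ∈ evenOdd (splitForm K n) 0) : cliffordFrob n φ x ∈ evenOdd (splitForm K n) 0 := by
  induction x, hx using CliffordAlgebra.even_induction with
  | algebraMap r =>
    rw [cliffordFrob_algebraMap]
    exact SetLike.algebraMap_mem_graded _ _
  | add x y hx hy ihx ihy =>
    rw [map_add]
    exact add_mem ihx ihy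
  | ι_mul_ι_mul v w x hx ih =>
    rw [map_mul, map_mul, cliffordFrob_ι, cliffordFrob_ι]
    exact zero_add (0 : ZMod 2) ▸ SetLike.mul_mem_graded (ι_mul_ι_mem_evenOdd_zero _ _ _) ih

theorem cliffordFrob_mem_splitSpin (φ : K →+* K) {x : (SplitClifford K n)ˣ}
    (hx : x ∈ splitSpin K n) :
    Units.map (cliffordFrob n φ : SplitClifford K n →* SplitClifford K n) x ∈ splitSpin K n := by
  rw [mem_splitSpin_iff] at hx ⊢
  obtain ⟨h1, h2, h3⟩ := hx
  refine ⟨cliffordFrob_mem_lipschitzGroup φ h1, ?_, cliffordFrob_mem_evenOdd_zero φ h3⟩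
  rw [Unitary.mem_iff] at h2 ⊢
  change star (cliffordFrob n φ x) * cliffordFrob n φ x = 1 ∧
    cliffordFrob n φ x * star (cliffordFrob n φ x) = 1
  rw [← cliffordFrob_star, ← map_mul, ← map_mul, h2.1, h2.2, map_one]
  exact ⟨rfl, rfl⟩

theorem cliffordFrob_basisVector (φ : K →+* K) (j : Fin n ⊕ Fin n) :
    cliffordFrob n φ (basisVector K n j) = basisVector K n j := by
  rw [basisVector, cliffordFrob_ι]
  congr 1
  ext i
  by_cases h : i = j <;> simp [h]

theorem cliffordFrob_smul (φ : K →+* K) (c : K) (x : SplitClifford K n) :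
    cliffordFrob n φ (c • x) = φ c • cliffordFrob n φ x := by
  rw [Algebra.smul_def, map_mul, cliffordFrob_algebraMap, Algebra.smul_def]

theorem ActsDiagonally.cliffordFrob (φ : K →+* K) {x : (SplitClifford K n)ˣ} {a : Fin n → Kˣ}
    (h : ActsDiagonally x a) : ActsDiagonally
      (Units.map (cliffordFrob n φ : SplitClifford K n →* SplitClifford K n) x)
      fun i => Units.map (φ : K →* K) (a i) := by
  have key : ∀ (j : Fin n ⊕ Fin n) (c : K),
      (x : SplitClifford K n) * basisVector K n j * ((x⁻¹ : (SplitClifford K n)ˣ)) =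
        c • basisVector K n j →
      _root_.cliffordFrob n φ x * basisVector K n j *
        _root_.cliffordFrob n φ (x⁻¹ : (SplitClifford K n)ˣ) = φ c • basisVector K n j := by
    intro j c hc
    have := congrArg (_root_.cliffordFrob n φ) hc
    rwa [map_mul, map_mul, cliffordFrob_smul, cliffordFrob_basisVector] at this
  intro i
  refine ⟨key _ _ (h i).1, ?_⟩
  have := key _ _ (h i).2
  rw [map_inv₀] at this
  exact this

/-! ### One-parameter subgroups of the torus of the spin group -/

/-- The element `r e f + r⁻¹ f e` attached to the hyperbolic pair `(e, f)` with index `b`. -/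
def hyperbolicElement (b : Fin n) (r : Kˣ) : SplitClifford K n :=
  (r : K) • (basisVector K n (Sum.inl b) * basisVector K n (Sum.inr b)) +
    ((r⁻¹ : Kˣ) : K) • (basisVector K n (Sum.inr b) * basisVector K n (Sum.inl b))

theorem inl_mul_inr_add (b : Fin n) :
    basisVector K n (Sum.inl b) * basisVector K n (Sum.inr b) +
      basisVector K n (Sum.inr b) * basisVector K n (Sum.inl b) = 1 := by
  simpa using basisVector_mul_add_swap (K := K) n (Sum.inl b) (Sum.inr b)

theorem inl_mul_inr_mul_inl (b : Fin n) :
    basisVector K n (Sum.inl b) * basisVector K n (Sum.inr b) * basisVector K n (Sum.inl b) =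
      basisVector K n (Sum.inl b) := by
  have h := congrArg (· * basisVector K n (Sum.inl b)) (inl_mul_inr_add (K := K) b)
  simpa [add_mul, mul_assoc, basisVector_mul_self] using h

theorem inr_mul_inl_mul_inr (b : Fin n) :
    basisVector K n (Sum.inr b) * basisVector K n (Sum.inl b) * basisVector K n (Sum.inr b) =
      basisVector K n (Sum.inr b) := by
  have h := congrArg (· * basisVector K n (Sum.inr b)) (inl_mul_inr_add (K := K) b)
  simpa [add_mul, mul_assoc, basisVector_mul_self] using h

/-- The elements `ef` and `fe` are orthogonal idempotents with sum `1`, so coefficients multiply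
separately. -/
theorem hyperbolicElement_mul (b : Fin n) (r s : Kˣ) :
    hyperbolicElement b (r * s) = hyperbolicElement b r * (hyperbolicElement b s) := by
  have h1 := inl_mul_inr_mul_inl (K := K) b
  have h2 := inr_mul_inl_mul_inr (K := K) b
  have h3 := basisVector_mul_self (K := K) n (Sum.inl b)
  have h4 := basisVector_mul_self (K := K) n (Sum.inr b)
  simp only [hyperbolicElement]
  generalize basisVector K n (Sum.inl b) = e at *
  generalize basisVector K n (Sum.inr b) = f at *
  have a1 : e * f * (e * f) = e * f := by rw [← mul_assoc, h1]
  have a2 : f * e * (f * e) = f * e := by rw [← mul_assoc, h2]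
  have a3 : e * f * (f * e) = 0 := by rw [mul_assoc, ← mul_assoc f f, h4, zero_mul, mul_zero]
  have a4 : f * e * (e * f) = 0 := by rw [mul_assoc, ← mul_assoc e e, h3, zero_mul, mul_zero]
  rw [add_mul, mul_add, mul_add]
  simp only [smul_mul_smul_comm, a1, a2, a3, a4, smul_zero, add_zero, zero_add, mul_inv,
    Units.val_mul]

theorem hyperbolicElement_one (b : Fin n) : hyperbolicElement b (1 : Kˣ) = 1 := by
  simp [hyperbolicElement, inl_mul_inr_add]

/-- The element `r e f + r⁻¹ f e` as a unit of the Clifford algebra. -/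
def hyperbolicUnit (K : Type v) [Field K] {n : ℕ} (b : Fin n) : Kˣ →* (SplitClifford K n)ˣ :=
  MonoidHom.toHomUnits
    { toFun := hyperbolicElement b
      map_one' := hyperbolicElement_one b
      map_mul' := hyperbolicElement_mul b }

theorem coe_hyperbolicUnit (b : Fin n) (r : Kˣ) :
    (hyperbolicUnit K b r : SplitClifford K n) = hyperbolicElement b r := rfl

theorem coe_hyperbolicUnit_inv (b : Fin n) (r : Kˣ) :
    (((hyperbolicUnit K b r)⁻¹ : (SplitClifford K n)ˣ) : SplitClifford K n) =
      hyperbolicElement b r⁻¹ := by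
  rw [← map_inv]; rfl

theorem star_hyperbolicElement (b : Fin n) (r : Kˣ) :
    star (hyperbolicElement b r) = hyperbolicElement b r⁻¹ := by
  simp only [hyperbolicElement, star_add, CliffordAlgebra.star_smul, star_mul, basisVector, star_ι, inv_inv,
    neg_mul_neg]
  rw [add_comm]

theorem hyperbolicUnit_mem_splitSpin (b : Fin n) (r : Kˣ) :
    hyperbolicUnit K b r ∈ splitSpin K n := by
  rw [mem_splitSpin_iff]
  refine ⟨?_, ?_, ?_⟩
  · have hunit : ∀ c : Kˣ, IsUnit (ι (splitForm K n)
        (Pi.single (Sum.inl b) 1 + (c : K) • Pi.single (Sum.inr b) 1 : Fin n ⊕ Fin n → K)) := by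
      intro c
      refine isUnit_ι_of_isUnit (Q := splitForm K n) ?_
      rw [splitForm_apply]
      have : ∑ i : Fin n, ((Pi.single (Sum.inl b) 1 + (c : K) • Pi.single (Sum.inr b) 1 :
          Fin n ⊕ Fin n → K) (Sum.inl i) * (Pi.single (Sum.inl b) 1 + (c : K) •
            Pi.single (Sum.inr b) 1 : Fin n ⊕ Fin n → K) (Sum.inr i)) = c := by
        simp [Pi.single_apply]
      rw [this]
      exact c.isUnit
    -- Since `e² = f² = 0`, the product `(e + r⁻¹f)(e + rf)` equals `r ef + r⁻¹ fe`; the two vectors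
    -- have norms `r⁻¹` and `r`, hence are invertible.
    have hprod : hyperbolicUnit K b r = (hunit r⁻¹).unit * (hunit r).unit := by
      ext
      rw [Units.val_mul, IsUnit.unit_spec, IsUnit.unit_spec, coe_hyperbolicUnit, hyperbolicElement]
      simp only [map_add, map_smul]
      change _ = (basisVector K n (Sum.inl b) + _ • basisVector K n (Sum.inr b)) *
        (basisVector K n (Sum.inl b) + _ • basisVector K n (Sum.inr b))
      simp [add_mul, mul_add, basisVector_mul_self, add_comm]
    rw [hprod]
    exact mul_mem (Subgroup.subset_closure ⟨_, (IsUnit.unit_spec _).symm⟩)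
      (Subgroup.subset_closure ⟨_, (IsUnit.unit_spec _).symm⟩)
  · rw [Unitary.mem_iff, coe_hyperbolicUnit, star_hyperbolicElement, ← hyperbolicElement_mul,
      ← hyperbolicElement_mul, inv_mul_cancel, mul_inv_cancel, hyperbolicElement_one]
    exact ⟨rfl, rfl⟩
  · rw [coe_hyperbolicUnit, hyperbolicElement]
    exact add_mem (Submodule.smul_mem _ _ (ι_mul_ι_mem_evenOdd_zero _ _ _))
      (Submodule.smul_mem _ _ (ι_mul_ι_mem_evenOdd_zero _ _ _))

/-- A basis vector outside the pair anticommutes with `e` and `f`, so it commutes with `ef` and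
`fe`. On `e` only `r² efe = r² e` survives, and similarly for `f` with `r⁻²`. -/
theorem actsDiagonally_hyperbolicUnit (b : Fin n) (r : Kˣ) :
    ActsDiagonally (hyperbolicUnit K b r) (Pi.mulSingle b (r ^ 2)) := by
  have h1 := inl_mul_inr_mul_inl (K := K) b
  have h2 := inr_mul_inl_mul_inr (K := K) b
  have h3 := basisVector_mul_self (K := K) n (Sum.inl b)
  have h4 := basisVector_mul_self (K := K) n (Sum.inr b)
  have hcomm : ∀ j, j ≠ Sum.inl b → j ≠ Sum.inr b → (hyperbolicUnit K b r : SplitClifford K n) *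
      basisVector K n j * ((hyperbolicUnit K b r)⁻¹ : (SplitClifford K n)ˣ) =
        basisVector K n j := by
    intro j hl hr
    rw [Units.mul_inv_eq_iff_eq_mul, coe_hyperbolicUnit, hyperbolicElement]
    have a1 : basisVector K n j * basisVector K n (Sum.inl b) =
        -(basisVector K n (Sum.inl b) * basisVector K n j) := by
      rw [eq_neg_iff_add_eq_zero, basisVector_mul_add_swap, if_neg]
      exact fun h => hr (by rw [← Sum.swap_swap j, ← h]; rfl)
    have a2 : basisVector K n j * basisVector K n (Sum.inr b) =
        -(basisVector K n (Sum.inr b) * basisVector K n j) := by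
      rw [eq_neg_iff_add_eq_zero, basisVector_mul_add_swap, if_neg]
      exact fun h => hl (by rw [← Sum.swap_swap j, ← h]; rfl)
    simp only [mul_add, add_mul, mul_smul_comm, smul_mul_assoc, ← mul_assoc, a1, a2, neg_mul]
    simp only [mul_assoc, a1, a2, mul_neg, neg_neg]
  intro i
  rcases eq_or_ne i b with rfl | hi
  · rw [Pi.mulSingle_eq_same, coe_hyperbolicUnit_inv, coe_hyperbolicUnit]
    simp only [hyperbolicElement]
    generalize basisVector K n (Sum.inl i) = e at *
    generalize basisVector K n (Sum.inr i) = f at *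
    constructor
    · simp only [add_mul, mul_add, smul_mul_assoc, mul_smul_comm, h1, mul_assoc f e e, h3,
        mul_zero, smul_zero, add_zero, zero_mul, ← mul_assoc e e, zero_add]
      rw [← mul_assoc, h1, smul_smul, inv_inv, Units.val_pow_eq_pow_val, sq]
    · simp only [add_mul, mul_add, smul_mul_assoc, mul_smul_comm, h2, mul_assoc e f f, h4,
        mul_zero, smul_zero, add_zero, zero_mul, ← mul_assoc f f, zero_add]
      rw [← mul_assoc, h2, smul_smul, Units.val_pow_eq_pow_val, sq, mul_inv, Units.val_inv_eq_inv_val]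
  · rw [Pi.mulSingle_eq_of_ne hi, hcomm _ (by simpa using hi) (by simp),
      hcomm _ (by simp) (by simpa using hi)]
    simp

end Spin

/-! ### The split torus model of the spin group -/

section SpinModel

variable {K : Type v} [Field K] {n : ℕ}

/-- The diagonal model of the spin group in characteristic two. -/
def spinDiagonalModel (h2 : (2 : K) = 0) (n : ℕ) (φ : K →+* K) :
    DiagonalModel (spinGroupWithTorus n φ) (Fin n ⊕ Fin n) where
  ρ := vectorRep K n
  injective := vectorRep_injective h2
  mem_torus_iff g := by
    constructor
    · rintro ⟨-, a, ha⟩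
      refine mem_diagonalSubgroup_of_offDiag fun k j hkj => ?_
      exact (congrFun (congrFun (ActsDiagonally.vectorRep_eq (x := g) ha) k) j).trans
        (Matrix.diagonal_apply_ne _ hkj)
    · exact fun h => ⟨g.2, actsDiagonally_of_vectorRep_mem h⟩

theorem spinDiagonalModel_entry (h2 : (2 : K) = 0) (φ : K →+* K)
    (t : spinTorus K n) {a : Fin n → Kˣ}
    (ha : ActsDiagonally (t : (SplitClifford K n)ˣ) a) (k : Fin n ⊕ Fin n) :
    (spinDiagonalModel h2 n φ).entry k t = Sum.elim a (fun i => (a i)⁻¹) k := by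
  ext
  change (vectorRep K n ⟨t.1, t.2.1⟩ : Matrix _ _ K) k k = _
  rw [ActsDiagonally.vectorRep_eq (x := ⟨t.1, t.2.1⟩) ha, Matrix.diagonal_apply_eq]
  rcases k with k | k <;> simp

/-- The model of the split spin group in characteristic two. -/
def spinModel {q : ℕ} {φ : K →+* K} (hφ : ∀ x, φ x = x ^ q) (n : ℕ) [CharP K 2] [PerfectRing K 2] :
    SplitTorusModel (spinGroupWithTorus n φ) q (Fin n ⊕ Fin n) (Fin n) :=
  have h2 : (2 : K) = 0 := CharTwo.two_eq_zero
  have hfrob : ∀ t ∈ (spinGroupWithTorus n φ).torus,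
      (spinGroupWithTorus n φ).frob t ∈ (spinGroupWithTorus n φ).torus :=
    fun _ ht => ⟨cliffordFrob_mem_splitSpin φ ht.1, _, ht.2.choose_spec.cliffordFrob φ⟩
  -- The hyperbolic elements act through `r²`, whereas the model needs a subgroup acting through `s`
  -- itself. Squaring is an automorphism of the perfect field `K` of characteristic two, so `r` can
  -- be taken to be the square root of `s`, multiplicatively in `s`.
  let sqrt : Kˣ →* Kˣ := Units.map ((frobeniusEquiv K 2).symm : K →* K)
  have hsqrt : ∀ s, sqrt s ^ 2 = s := fun s => Units.ext (frobeniusEquiv_symm_pow_p K 2 (s : K))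
  have hacts : ∀ b s, ActsDiagonally (hyperbolicUnit K (n := n) b (sqrt s)) (Pi.mulSingle b s) :=
    fun b s => by simpa only [hsqrt] using actsDiagonally_hyperbolicUnit b (sqrt s)
  { toDiagonalModel := spinDiagonalModel h2 n φ
    frob_mem := hfrob
    entry_frob := fun k t => by
      obtain ⟨a, ha⟩ := t.2.2
      refine (spinDiagonalModel_entry h2 φ ⟨_, hfrob t t.2⟩ (ha.cliffordFrob φ) k).trans ?_
      rw [spinDiagonalModel_entry h2 φ t ha]
      rcases k with k | k <;> ext <;> simp [hφ]
    c := Sum.inl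
    c_injective := Sum.inl_injective
    ε_eq := fun j => MonoidHom.ext fun t =>
      (spinDiagonalModel_entry h2 φ t t.2.2.choose_spec (Sum.inl j)).symm
    γ := fun b => ((hyperbolicUnit K b).comp sqrt).codRestrict _
      fun s => ⟨hyperbolicUnit_mem_splitSpin b _, _, hacts b s⟩
    p := fun b => Pi.single (Sum.inl b) 1 - Pi.single (Sum.inr b) 1
    entry_γ := fun b k s => by
      refine (spinDiagonalModel_entry h2 φ _ (hacts b s) k).trans ?_
      rcases k with k | k <;> by_cases h : k = b <;> simp [h]
    abs_sum_p_le := fun b A => abs_sum_single_sub_single_le _ _ A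
    eq_of_p_eq := hyperbolic_eq_of_eq n
    d := Sum.inl
    prod_entry_d := fun t k => by
      obtain ⟨a, ha⟩ := t.2.2
      refine prod_hyperbolic n (a := fun k => (spinDiagonalModel h2 n φ).entry k t) (fun j => ?_) k
      rw [spinDiagonalModel_entry h2 φ t ha, spinDiagonalModel_entry h2 φ t ha]
      simp }

end SpinModel

/-! ### Assembly of the six families -/

/-- Every classical group has a split torus model. -/
theorem ClassicalFamily.exists_splitTorusModel {F : Type u} [Field F] [Fintype F] {K : Type v}
    [Field K] [Algebra F K] [IsAlgClosed K] (X : ClassicalFamily)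
    (hX : X.Admissible (Fintype.card F)) (n : ℕ) :
    ∃ (ι B : Type) (_ : Fintype ι) (_ : DecidableEq ι) (_ : Fintype B),
      Nonempty (SplitTorusModel (X.toGroup F K n) (Fintype.card F) ι B) := by
  have hφ : ∀ x : K, ClassicalFamily.frobenius F K x = x ^ Fintype.card F := fun _ => rfl
  cases X with
  | generalLinear => exact ⟨_, _, _, _, _, ⟨generalLinearModel hφ n⟩⟩
  | specialLinear => exact ⟨_, _, _, _, _, ⟨specialLinearModel hφ n⟩⟩
  | symplectic => exact ⟨_, _, _, _, _, ⟨symplecticModel hφ n⟩⟩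
  | oddOrthogonal => exact ⟨_, _, _, _, _, ⟨oddOrthogonalModel hφ n⟩⟩
  | plusOrthogonal => exact ⟨_, _, _, _, _, ⟨plusOrthogonalModel hφ n⟩⟩
  | plusSpin =>
    have hchar : ringChar F = 2 :=
      (FiniteField.even_card_iff_char_two).2 (Nat.even_iff.1 hX)
    have : CharP F 2 := hchar ▸ ringChar.charP F
    have : CharP K 2 := charP_of_injective_algebraMap (algebraMap F K).injective 2
    exact ⟨_, _, _, _, _, ⟨spinModel hφ n⟩⟩

end

theorem theorem1 {F : Type u} [Field F] [Fintype F] {K : Type v} [Field K] [Algebra F K]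
    [IsAlgClosure F K] (X : ClassicalFamily) (hX : X.Admissible (Fintype.card F))
    (n i : ℕ) (hi : 1 ≤ i) (hin : i ≤ n)
    (w : (X.toGroup F K n).Weyl) (x : (X.toGroup F K n).Amb)
    (hx : (X.toGroup F K n).Twists x w) :
    -- the number of weights `g(μ)`, `μ = (q - 1) ωᵢ`, that are trivial on the torus `T_w`
    ((Set.ncard {ν ∈ (X.toGroup F K n).weightOrbit x
          ((X.toGroup F K n).ω i ^ (Fintype.card F - 1)) |
        ∀ t : (X.toGroup F K n).conjugateTorus x,
          (t : (X.toGroup F K n).Amb) ∈ (X.toGroup F K n).finiteTorus x → ν t = 1} : ℕ) : ℂ) =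
      inducedCharacter ((X.toGroup F K n).weylStabilizer i) (fun _ => 1) w ∧
    -- the number of weights `g(ωᵢ)` that take their values on `T_w` in the field of `q` elements
    ((Set.ncard {ν ∈ (X.toGroup F K n).weightOrbit x ((X.toGroup F K n).ω i) |
        ∀ t : (X.toGroup F K n).conjugateTorus x,
          (t : (X.toGroup F K n).Amb) ∈ (X.toGroup F K n).finiteTorus x →
            (ν t : K) ∈ Set.range (algebraMap F K)} : ℕ) : ℂ) =
      inducedCharacter ((X.toGroup F K n).weylStabilizer i) (fun _ => 1) w := by

  have : IsAlgClosed K := IsAlgClosure.isAlgClosed F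
  obtain ⟨ι, B, _, _, _, ⟨M⟩⟩ := X.exists_splitTorusModel (K := K) hX n
  have hq : ((Fintype.card F : ℕ) : K) = 0 := by
    rw [← map_natCast (algebraMap F K), FiniteField.cast_card_eq_zero, map_zero]
  have h := M.ncard_weights_eq hq Fintype.one_lt_card i hx
  simp only [mem_range_algebraMap_iff_pow_card_sub_one]
  exact h
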